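/- **Definitions.** Let $0\le m\le q$ and $0\le n\le p$ be integers, $a_i,b_j\in\mathbb C$ and $A_i,\alpha_i,B_j,\beta_j>0$ ($1\le i\le p$, $1\le j\le q$), and let $$\chi(w)=\frac{\prod_{i=1}^{n}\Gamma^{\alpha_i}(1-a_i-A_iw)\,\prod_{j=1}^{m}\Gamma^{\beta_j}(b_j+B_jw)}{\prod_{i=n+1}^{p}\Gamma^{\alpha_i}(a_i+A_iw)\,\prod_{j=m+1}^{q}\Gamma^{\beta_j}(1-b_j-B_jw)},\qquad \Gamma^{e}(z)=e^{e\log\Gamma(z)},$$ with the principal branch of $\log\Gamma$ (analytic off $(-\infty,0]$, real on $(0,\infty)$). Let $C$ be a path from $c-i\infty$ to $c+i\infty$, $c\in\mathbb R$: a simple rectifiable curve (with a Lipschitz parametrization $\gamma:\mathbb R\to\mathbb C$) that has $\gamma(t)=c+it$ for all large $|t|$. The $I$-function along $C$ is $$I^{m,n}_{p,q}\left[z\,\middle|\begin{matrix}(a_i,A_i,\alpha_i)_{1,p}\\(b_j,B_j,\beta_j)_{1,q}\end{matrix}\right]=\frac1{2\pi i}\int_C\chi(w)z^{-w}\,dw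 ,$$ where $z^{-w}$ is the principal power. The path is *admissible* for it if all the singularities (in $w$) of the factors $\Gamma^{\beta_j}(b_j+B_jw)$, $j\le m$, lie to the left of $C$ and all those of $\Gamma^{\alpha_i}(1-a_i-A_iw)$, $i\le n$, lie to its right. The same definitions are used if a triple has $A=0$ or $B=0$; a numerator factor is then constant, and admissibility means that it is finite. Let $\delta,k_2\in\mathbb C$, $\delta\ne0$, let $\sigma\ge0$, and let $a,b,\alpha\in\mathbb R$ satisfy: $a>0,\ b\ge0$ if $\alpha>0$; $a\ge0,\ b>0$ if $\alpha<0$; $a>0,\ b>0$ if $\alpha=0$. The $I$-function inverse Gaussian (I-FIG) density is $$f(x)=k_2\,x^{\alpha-1}e^{-ax-bx^{-1}}\,I^{m,n}_{p,q}\left[\delta x^{\sigma}\,\middle|\begin{matrix}(a_i,A_i,\alpha_i)_{1,p}\\(b_j,B_j,\beta_j)_{1,q}\end{matrix}\right]\quad(x>0),\qquad f(x)=0\quad(x\le0).$$ **Theorem.** Let $s\in\mathbb C$. Let all $I$-functions be taken along one path $C$, which is admissible for the $I$-functions on the right-hand side of (1) below (hence also for the one in $f$), and suppose that $\int_C|\chi(w)\,\delta^{-w}|\,|dw|<\infty$.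 If $b=0$, suppose also that $\operatorname{Re}(\alpha+s-1-\sigma w)>0$ for all $w\in C$; if $a=0$, suppose that $\sigma=0$ and $\operatorname{Re}(\alpha+s-1)<0$. Then the integrals that define $I^{m,n}_{p,q}[\delta x^\sigma]$ ($x>0$), the Mellin transform $\mathcal M_f(s)=\int_0^\infty x^{s-1}f(x)\,dx$, the $I$-functions on the right of (1), and the series in (1) all converge absolutely, and $$\begin{aligned}\mathcal M_f(s)=k_2\sum_{l=0}^\infty\Bigg\{&a^{-\alpha-s+1}\,I^{m+1,n+1}_{p+2,q+1}\left[\frac{\delta}{a^\sigma}\,\middle|\begin{matrix}(2-\alpha-s,\sigma,1)&(a_i,A_i,\alpha_i)_{1,p}&(2+l-\alpha-s,\sigma,1)\\(2-\alpha-s,\sigma,1)&(b_j,B_j,\beta_j)_{1,q}\end{matrix}\right]\\&-b^{\alpha+s-1}\,I^{m+1,n+1}_{p+1,q+2}\left[b^\sigma\delta\,\middle|\begin{matrix}(2-\alpha-s,\sigma,1)&(a_i,A_i,\alpha_i)_{1,p}\\(2-\alpha-s,\sigma,1)&(b_j,B_j,\beta_j)_{1,q}&(1-l-\alpha-s,\sigma,1)\end{matrix}\right]\Bigg\}\frac{(ab)^l}{l!}.\end{aligned}\tag{1}$$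 (Here $0^0=1$; for $b=0$ the second summand, and for $a=0$ the first summand, in the braces is read as $0$.) In particular, if $f$ takes only real values $\ge0$ and $X$ is a random variable with probability density function $f$, then $X^{s-1}$ is integrable and $E[X^{s-1}]$ equals the right-hand side of (1). -/

import Mathlib

open MeasureTheory Set

noncomputable section

namespace IFunction

/-- The principal branch of `log Γ`, by its Weierstrass series
`log Γ(z) = -γ z - log z + ∑_{k ≥ 1} (z / k - log (1 + z / k))`. It is analytic off the half-line
`(-∞, 0]` and real on `(0, ∞)`. It differs in general from the principal logarithm of `Γ(z)`. -/
def logGamma (z : ℂ) : ℂ :=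
  -(Real.eulerMascheroniConstant : ℂ) * z - Complex.log z
    + ∑' k : ℕ, (z / ((k : ℂ) + 1) - Complex.log (1 + z / ((k : ℂ) + 1)))

/-- The arguments at which `Γ` (hence also a positive power of it) is singular. -/
def IsGammaPole (z : ℂ) : Prop := ∃ k : ℕ, z = -(k : ℂ)

open Classical in
/-- The power `Γ^e(z) = exp (e log Γ(z))`. At a pole of `Γ` it is given the value `0`, so that the
factor `1 / Γ^e(z)` (for `e > 0`) takes there its correct value `0` too. -/
def gammaPow (e : ℝ) (z : ℂ) : ℂ :=
  if IsGammaPole z then 0 else Complex.exp ((e : ℂ) * logGamma z)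

/-- A parameter triple `(a, A, α)` of an `I`-function. -/
structure Param where
  /-- the shift `a` -/
  shift : ℂ
  /-- the slope `A` -/
  slope : ℝ
  /-- the exponent `α` of the Gamma function -/
  expo : ℝ

variable {p q : ℕ}

/-- The integrand `χ(w)` of the Mellin-Barnes integral, with upper parameters
`P i = (a_i, A_i, α_i)` and lower parameters `Q j = (b_j, B_j, β_j)`. Indices start at `0`, so the
first `n` upper ones are those with `i < n`. -/
def chi (m n : ℕ) (P : Fin p → Param) (Q : Fin q → Param) (w : ℂ) : ℂ :=
  ((∏ i : Fin p with i.val < n, gammaPow (P i).expo (1 - (P i).shift - (P i).slope * w)) *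
    ∏ j : Fin q with j.val < m, gammaPow (Q j).expo ((Q j).shift + (Q j).slope * w)) /
  ((∏ i : Fin p with n ≤ i.val, gammaPow (P i).expo ((P i).shift + (P i).slope * w)) *
    ∏ j : Fin q with m ≤ j.val, gammaPow (Q j).expo (1 - (Q j).shift - (Q j).slope * w))

/-- A path of integration from `c - i∞` to `c + i∞`: a simple rectifiable curve (with a Lipschitz
parametrization), which agrees with the vertical line `Re w = c`, run through upwards, outside a
bounded set. -/
structure Contour where
  /-- the abscissa at both ends -/
  c : ℝ
  /-- the parametrization -/
  path : ℝ → ℂ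
  lipschitz : ∃ K, LipschitzWith K path
  injective : Function.Injective path
  tail : ∃ T : ℝ, ∀ t : ℝ, T ≤ |t| → path t = (c : ℂ) + (t : ℂ) * Complex.I

/-- `w` lies to the left of `C`: it can be joined, off `C`, to all real points that are sufficiently
far to the left. -/
def Contour.IsLeft (C : Contour) (w : ℂ) : Prop :=
  ∃ r : ℝ, ∀ x : ℝ, x ≤ r → JoinedIn (range C.path)ᶜ w (x : ℂ)

/-- `w` lies to the right of `C`. -/
def Contour.IsRight (C : Contour) (w : ℂ) : Prop :=
  ∃ r : ℝ, ∀ x : ℝ, r ≤ x → JoinedIn (range C.path)ᶜ w (x : ℂ)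

/-- `C` separates the singularities: those of `Γ^{β_j}(b_j + B_j w)`, `j ≤ m`, lie to its left and
those of `Γ^{α_i}(1 - a_i - A_i w)`, `i ≤ n`, to its right. If a slope is `0`, the factor is
constant, and the condition says that it is finite. -/
def Separates (C : Contour) (m n : ℕ) (P : Fin p → Param) (Q : Fin q → Param) : Prop :=
  (∀ j : Fin q, j.val < m → ∀ w : ℂ,
    IsGammaPole ((Q j).shift + (Q j).slope * w) → C.IsLeft w) ∧
  (∀ i : Fin p, i.val < n → ∀ w : ℂ,
    IsGammaPole (1 - (P i).shift - (P i).slope * w) → C.IsRight w)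

/-- The integrand `χ(w) z^{-w} dw` along the path `C`. -/
def integrand (C : Contour) (m n : ℕ) (P : Fin p → Param) (Q : Fin q → Param) (z : ℂ) (t : ℝ) :
    ℂ :=
  chi m n P Q (C.path t) * z ^ (-C.path t) * deriv C.path t

/-- The integral that defines the `I`-function at `z` converges absolutely. -/
def ConvergesAt (C : Contour) (m n : ℕ) (P : Fin p → Param) (Q : Fin q → Param) (z : ℂ) : Prop :=
  Integrable (integrand C m n P Q z)

/-- The `I`-function `I^{m,n}_{p,q}[z | P ; Q] = (2πi)⁻¹ ∫_C χ(w) z^{-w} dw`. -/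
def I (C : Contour) (m n : ℕ) (P : Fin p → Param) (Q : Fin q → Param) (z : ℂ) : ℂ :=
  (2 * (Real.pi : ℂ) * Complex.I)⁻¹ * ∫ t : ℝ, integrand C m n P Q z t

/-- The parameter row `u, P_1, …, P_p`. -/
def prepend (u : Param) (P : Fin p → Param) : Fin (p + 1) → Param :=
  Fin.cons (α := fun _ => Param) u P

/-- The parameter row `P_1, …, P_p, u`. -/
def postpend (P : Fin p → Param) (u : Param) : Fin (p + 1) → Param :=
  Fin.snoc (α := fun _ => Param) P u

/-- The `I`-function inverse Gaussian density
`f(x) = k₂ x^{α-1} e^{-a x - b / x} I^{m,n}_{p,q}[δ x^σ]` for `x > 0`, and `0` otherwise. -/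
def ifigDensity (C : Contour) (m n : ℕ) (P : Fin p → Param) (Q : Fin q → Param)
    (k₂ δ : ℂ) (a b α σ : ℝ) (x : ℝ) : ℂ :=
  if 0 < x then
    k₂ * ((x ^ (α - 1) * Real.exp (-a * x - b * x⁻¹) : ℝ) : ℂ) *
      I C m n P Q (δ * ((x ^ σ : ℝ) : ℂ))
  else 0

/-- The `l`-th term of the series for the Mellin transform. -/
def ifigMellinTerm (C : Contour) (m n : ℕ) (P : Fin p → Param) (Q : Fin q → Param)
    (δ : ℂ) (a b α σ : ℝ) (s : ℂ) (l : ℕ) : ℂ :=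
  ((a : ℂ) ^ (-(α : ℂ) - s + 1) *
      I C (m + 1) (n + 1)
        (prepend ⟨2 - α - s, σ, 1⟩ (postpend P ⟨2 + l - α - s, σ, 1⟩))
        (prepend ⟨2 - α - s, σ, 1⟩ Q)
        (δ / ((a ^ σ : ℝ) : ℂ))
    - (b : ℂ) ^ ((α : ℂ) + s - 1) *
      I C (m + 1) (n + 1)
        (prepend ⟨2 - α - s, σ, 1⟩ P)
        (prepend ⟨2 - α - s, σ, 1⟩ (postpend Q ⟨1 - l - α - s, σ, 1⟩))
        (((b ^ σ : ℝ) : ℂ) * δ))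
    * (((a * b) ^ l / (l.factorial : ℝ) : ℝ) : ℂ)

end IFunction

end

noncomputable section

namespace IFunction

open Filter Topology

variable {p q : ℕ}

/-! Write `ν(w) = α + s - 1 - σ w` and `K(z) = ∫_0^∞ x^(z-1) e^(-a x - b/x) dx`. Inserting the
Mellin-Barnes integral into the Mellin transform and applying Fubini turns the left side of (1) into
`k₂ (2πi)⁻¹ ∫_C χ(w) δ^(-w) K(ν(w)) dw`. It remains to expand `K`, a modified Bessel function up to
elementary factors, and to integrate term by term.

For `z` not an integer, `K(z) = ∑_l (a^(-z) c_l(z) + b^z c_l(-z)) (ab)^l / l!` with `c_l(z) = (-1)^l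
Γ(z-l) = Γ(z)Γ(1-z)/Γ(1+l-z)` (`hasSum_mellin_expPair`). To prove it for `a, b > 0`, cut the
integral at `x = 1`; inversion makes the piece over `(0, 1)` another piece over `(1, ∞)` with `a, b`
exchanged. Expanding one exponential in each piece gives upper incomplete Gamma functions, and each
of these is a complete Gamma function minus a power series. The resulting two double series are
absolutely convergent and cancel.

Admissibility is what makes this usable: the poles of `Γ(ν)` and of `Γ(1-ν)` are off the path, so
`ν` avoids all integers there (`Contour.ne_intCast_of_separates`). Since the path is a vertical line
outside a compact set, `ν` even keeps a distance `ε > 0` from them, `Γ(±ν)` is bounded and `Re ν`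
stays in a compact interval (`Contour.besselOrders`). The recursion for `c_l` then gives `|c_l(ν)| ≤
M ε^(-l)`, and `1/l!` makes the sum converge uniformly along the path.

Finally `c_l(ν)` and `-c_l(-ν)` are exactly the Gamma quotients that the additional parameters in
(1) contribute to `χ`. -/

/-! ### The Weierstrass series of `log Γ` -/

theorem summable_logGamma_series (z : ℂ) :
    Summable fun k : ℕ => z / ((k : ℂ) + 1) - Complex.log (1 + z / ((k : ℂ) + 1)) := by
  have hsum : Summable fun k : ℕ => ‖z‖ ^ 2 * (1 / ((k : ℝ) + 1) ^ 2) := by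
    have := (summable_nat_add_iff 1).2 (Real.summable_one_div_nat_pow.2 one_lt_two)
    exact (by simpa using this : Summable fun k : ℕ => 1 / ((k : ℝ) + 1) ^ 2).mul_left _
  refine hsum.of_norm_bounded_eventually_nat ?_
  obtain ⟨N, hN⟩ := exists_nat_gt (2 * ‖z‖)
  filter_upwards [eventually_ge_atTop N] with k hk
  have hk' : (N : ℝ) ≤ k := by exact_mod_cast hk
  have hpos : (0 : ℝ) < (k : ℝ) + 1 := by positivity
  have hnorm : ‖z / ((k : ℂ) + 1)‖ = ‖z‖ / ((k : ℝ) + 1) := by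
    rw [norm_div]
    congr 1
    exact_mod_cast Complex.norm_natCast (k + 1)
  have hle : ‖z‖ / ((k : ℝ) + 1) ≤ 1 / 2 := by
    rw [div_le_iff₀ hpos]; linarith
  have h := Complex.norm_log_one_add_sub_self_le (z := z / ((k : ℂ) + 1))
    (by rw [hnorm]; linarith)
  rw [norm_sub_rev, hnorm] at h
  refine h.trans ?_
  have h2 : (1 - ‖z‖ / ((k : ℝ) + 1))⁻¹ ≤ 2 := by
    rw [inv_le_comm₀ (by linarith) two_pos]; linarith
  calc (‖z‖ / ((k : ℝ) + 1)) ^ 2 * (1 - ‖z‖ / ((k : ℝ) + 1))⁻¹ / 2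
      ≤ (‖z‖ / ((k : ℝ) + 1)) ^ 2 * 2 / 2 := by gcongr
    _ = ‖z‖ ^ 2 * (1 / ((k : ℝ) + 1) ^ 2) := by rw [div_pow]; ring

/-- Only exponentials of logarithms enter, so no branch has to be tracked; the terms `z / (k + 1)`
add up to a harmonic number. -/
theorem exp_logGamma_partial {z : ℂ} (hz : ¬ IsGammaPole z) (n : ℕ) :
    Complex.exp (∑ k ∈ Finset.range n, (z / ((k : ℂ) + 1) - Complex.log (1 + z / ((k : ℂ) + 1)))) *
      ∏ j ∈ Finset.range n, (z + (j + 1)) = Complex.exp (z * (harmonic n : ℝ)) * n.factorial := by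
  induction n with
  | zero => simp
  | succ n ih =>
    have hn : (n : ℂ) + 1 ≠ 0 := Nat.cast_add_one_ne_zero n
    have hzn : z + (n + 1) ≠ 0 := fun h => hz ⟨n + 1, by push_cast; linear_combination h⟩
    have hne : 1 + z / ((n : ℂ) + 1) ≠ 0 := by
      intro h; field_simp at h; apply hzn; linear_combination h
    rw [Finset.sum_range_succ, Finset.prod_range_succ, Complex.exp_add, Complex.exp_sub,
      Complex.exp_log hne, harmonic_succ, Nat.factorial_succ]
    push_cast at ih ⊢
    rw [mul_add z (harmonic n : ℂ), Complex.exp_add]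
    have e : z * ((n : ℂ) + 1)⁻¹ = z / ((n : ℂ) + 1) := rfl
    rw [e]
    have e2 : 1 + z / ((n : ℂ) + 1) = (z + (n + 1)) / (n + 1) := by field_simp; ring
    rw [e2]
    generalize Complex.exp (z / ((n : ℂ) + 1)) = u
    generalize Complex.exp (∑ k ∈ Finset.range n,
      (z / ((k : ℂ) + 1) - Complex.log (1 + z / ((k : ℂ) + 1)))) = v at ih ⊢
    generalize ∏ j ∈ Finset.range n, (z + ((j : ℂ) + 1)) = v' at ih ⊢
    field_simp
    linear_combination u * ih

/-- The Weierstrass product of the Gamma function, in logarithmic form. -/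
theorem exp_logGamma {z : ℂ} (hz : ¬ IsGammaPole z) :
    Complex.exp (logGamma z) = Complex.Gamma z := by
  have hz0 : z ≠ 0 := fun h => hz ⟨0, by simpa using h⟩
  have h1 := (((summable_logGamma_series z).hasSum.tendsto_sum_nat).const_add
    (-(Real.eulerMascheroniConstant : ℂ) * z - Complex.log z)).cexp
  refine tendsto_nhds_unique h1 ?_
  -- This factor, tending to `1` by the definition of Euler's constant, is the quotient of the
  -- Weierstrass partial product and Euler's sequence for `Γ(z)`.
  have h2 : Tendsto (fun n : ℕ => Complex.exp (z * ((harmonic n - Real.log n -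
      Real.eulerMascheroniConstant : ℝ) : ℂ))) atTop (𝓝 1) := by
    have := (Real.tendsto_harmonic_sub_log.sub_const Real.eulerMascheroniConstant)
    rw [sub_self] at this
    have := ((Complex.continuous_ofReal.tendsto _).comp this).const_mul z
    simpa using this.cexp
  have h3 := h2.mul (Complex.GammaSeq_tendsto_Gamma z)
  rw [one_mul] at h3
  refine h3.congr' ?_
  filter_upwards [eventually_gt_atTop 0] with n hn
  have hn0 : (n : ℂ) ≠ 0 := by exact_mod_cast hn.ne'
  have hprod : ∏ j ∈ Finset.range n, (z + (j + 1)) ≠ 0 :=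
    Finset.prod_ne_zero_iff.2 fun j _ h => hz ⟨j + 1, by push_cast; linear_combination h⟩
  have h := exp_logGamma_partial hz n
  rw [← eq_div_iff hprod] at h
  rw [Complex.exp_add, Complex.exp_sub, Complex.exp_log hz0, h, Complex.GammaSeq,
    Finset.prod_range_succ', Complex.cpow_def_of_ne_zero hn0]
  push_cast
  rw [show z * ((harmonic n : ℂ) - Complex.log n - Real.eulerMascheroniConstant) =
    -(Real.eulerMascheroniConstant : ℂ) * z + z * harmonic n - Complex.log n * z by ring,
    Complex.exp_sub, Complex.exp_add]
  have := Complex.exp_ne_zero (Complex.log n * z)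
  rw [add_zero]
  field_simp

/-- The first power of the Gamma function, in the sense of `gammaPow`, is the Gamma function. -/
theorem gammaPow_one (z : ℂ) : gammaPow 1 z = Complex.Gamma z := by
  unfold gammaPow
  split_ifs with h
  · obtain ⟨k, rfl⟩ := h
    exact (Complex.Gamma_neg_nat_eq_zero k).symm
  · simpa using exp_logGamma h

/-! ### The Mellin transform of `exp (-a x - b / x)`, cut at `x = 1` -/

/-- As `|u| ≤ 1`, the `k`-th term has `L¹` norm at most `|c|^k / k! · ∫ |h|`. It is used with `u =
1/x` on `(1, ∞)` and with `u = x` on `(0, 1]`. -/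
theorem hasSum_integral_mul_exp {X : Type*} [MeasurableSpace X] {μ : Measure X} {h : X → ℂ}
    (hh : Integrable h μ) {u : X → ℝ} (hu : AEStronglyMeasurable u μ) (hu1 : ∀ᵐ x ∂μ, |u x| ≤ 1)
    (c : ℝ) :
    HasSum (fun k : ℕ => (c : ℂ) ^ k / (k.factorial : ℂ) * ∫ x, h x * (u x : ℂ) ^ k ∂μ)
      (∫ x, h x * (Real.exp (c * u x) : ℝ) ∂μ) := by
  have hint : ∀ k : ℕ, Integrable (fun x => h x * (u x : ℂ) ^ k) μ := fun k => by
    refine hh.mul_bdd (c := 1) ?_ ?_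
    · exact (Complex.continuous_ofReal.comp_aestronglyMeasurable hu).pow k
    · filter_upwards [hu1] with x hx
      rw [norm_pow, Complex.norm_real]
      exact pow_le_one₀ (norm_nonneg _) hx
  have key := hasSum_integral_of_summable_integral_norm (μ := μ)
    (F := fun (k : ℕ) x => (c : ℂ) ^ k / (k.factorial : ℂ) * (h x * (u x : ℂ) ^ k))
    (fun k => (hint k).const_mul _) ?_
  · have e : ∫ x, h x * (Real.exp (c * u x) : ℝ) ∂μ =
        ∫ x, ∑' k : ℕ, (c : ℂ) ^ k / (k.factorial : ℂ) * (h x * (u x : ℂ) ^ k) ∂μ := by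
      refine integral_congr_ae (Eventually.of_forall fun x => ?_)
      have : HasSum (fun k : ℕ => (c : ℂ) ^ k / (k.factorial : ℂ) * (h x * (u x : ℂ) ^ k))
          (h x * (Real.exp (c * u x) : ℝ)) := by
        rw [Complex.ofReal_exp, Complex.exp_eq_exp_ℂ]
        have := (NormedSpace.expSeries_div_hasSum_exp ((c * u x : ℝ) : ℂ)).mul_left (h x)
        refine this.congr_fun ?_
        intro k
        push_cast
        rw [mul_pow]; ring
      exact this.tsum_eq.symm
    rw [e]
    simpa only [integral_const_mul] using key
  · have hs := (Real.summable_pow_div_factorial |c|).mul_right (∫ x, ‖h x‖ ∂μ)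
    refine hs.of_nonneg_of_le (fun k => integral_nonneg fun x => norm_nonneg _) fun k => ?_
    rw [← integral_const_mul]
    refine integral_mono_ae ((hint k).const_mul _).norm (hh.norm.const_mul _) ?_
    filter_upwards [hu1] with x hx
    simp only [norm_mul, norm_div, norm_pow, Complex.norm_real, Complex.norm_natCast,
      Real.norm_eq_abs]
    exact mul_le_mul_of_nonneg_left
      (mul_le_of_le_one_right (norm_nonneg _) (pow_le_one₀ (abs_nonneg _) hx)) (by positivity)

/-- The exponential factor of the generalized inverse Gaussian density. -/
def expPair (a b x : ℝ) : ℂ := ((Real.exp (-a * x - b * x⁻¹) : ℝ) : ℂ)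

/-- The restriction of `expPair a b` to `(1, ∞)`. -/
def expPairTail (a b : ℝ) : ℝ → ℂ := (Ioi 1).indicator (expPair a b)

theorem expPair_inv (a b x : ℝ) : expPair a b x⁻¹ = expPair b a x := by
  unfold expPair; rw [inv_inv]; congr 2; ring

theorem measurable_expPair (a b : ℝ) : Measurable (expPair a b) := by
  unfold expPair; fun_prop

theorem norm_expPair (a b x : ℝ) : ‖expPair a b x‖ = Real.exp (-a * x - b * x⁻¹) := by
  rw [expPair, Complex.norm_real, Real.norm_of_nonneg (Real.exp_nonneg _)]

theorem hasMellin_expPair_zero {a : ℝ} (ha : 0 < a) {s : ℂ} (hs : 0 < s.re) :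
    HasMellin (expPair a 0) s ((a : ℂ) ^ (-s) * Complex.Gamma s) := by
  have h1 : expPair a 0 = fun x : ℝ => expPair 1 0 (a * x) := by
    ext x; simp [expPair]
  have h2 : ∀ x : ℝ, expPair 1 0 x = (Real.exp (-x) : ℝ) := fun x => by simp [expPair]
  rw [h1]
  constructor
  · rw [MellinConvergent.comp_mul_left ha]
    refine (Complex.GammaIntegral_convergent hs).congr_fun (fun x _ => ?_) measurableSet_Ioi
    simp only [smul_eq_mul, h2]; rw [mul_comm]
  · rw [mellin_comp_mul_left _ _ ha, Complex.Gamma_eq_integral hs, Complex.GammaIntegral_eq_mellin,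
      smul_eq_mul]
    simp only [mellin, h2]

theorem mellinConvergent_expPairTail {a b : ℝ} (ha : 0 < a) (hb : 0 ≤ b) (s : ℂ) :
    MellinConvergent (expPairTail a b) s := by
  -- On `x > 1` a larger exponent only enlarges the integrand; one that is at least `1` makes the
  -- Gamma integral converge at `0` too.
  have h := (hasMellin_expPair_zero ha (s := ((max s.re 1 : ℝ) : ℂ))
    (by rw [Complex.ofReal_re]; exact lt_of_lt_of_le one_pos (le_max_right _ _))).1
  refine Integrable.mono h ?_ ?_
  · exact (((Complex.measurable_ofReal.pow_const _)).mul
      ((measurable_expPair a b).indicator measurableSet_Ioi)).aestronglyMeasurable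
  · filter_upwards [ae_restrict_mem measurableSet_Ioi] with x hx
    have hx : 0 < x := hx
    simp only [norm_smul, expPairTail]
    by_cases h1 : x ∈ Ioi (1 : ℝ)
    · rw [indicator_of_mem h1, norm_expPair, norm_expPair, Complex.norm_cpow_eq_rpow_re_of_pos hx,
        Complex.norm_cpow_eq_rpow_re_of_pos hx]
      simp only [Complex.sub_re, Complex.one_re, Complex.ofReal_re]
      gcongr
      · exact le_of_lt h1
      · exact le_max_left _ _
    · rw [indicator_of_notMem h1]; simp; positivity

/-- Inversion exchanges `a` and `b` and maps `(0, 1)` onto `(1, ∞)`. Only `x = 1` is missed by both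
tails. -/
theorem expPair_ae_eq (a b : ℝ) : ∀ᵐ x ∂(volume.restrict (Ioi (0 : ℝ))),
    expPair a b x = expPairTail a b x + expPairTail b a x⁻¹ := by
  have h1 : ∀ᵐ x ∂(volume.restrict (Ioi (0 : ℝ))), x ≠ 1 :=
    ae_restrict_of_ae (Measure.ae_ne volume 1)
  filter_upwards [ae_restrict_mem measurableSet_Ioi, h1] with x hx hx1
  have hx : 0 < x := hx
  unfold expPairTail
  rcases lt_or_gt_of_ne hx1 with h | h
  · rw [indicator_of_notMem (by simpa using h.le),
      indicator_of_mem (show x⁻¹ ∈ Ioi (1 : ℝ) from (one_lt_inv₀ hx).2 h), expPair_inv, zero_add]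
  · rw [indicator_of_mem (show x ∈ Ioi (1 : ℝ) from h), indicator_of_notMem, add_zero]
    simpa using (inv_lt_one_of_one_lt₀ h).le

theorem mellinConvergent_comp_inv {f : ℝ → ℂ} {s : ℂ} :
    MellinConvergent (fun x => f x⁻¹) s ↔ MellinConvergent f (-s) := by
  have := MellinConvergent.comp_rpow (f := f) (s := s) (a := -1) (by norm_num)
  simpa [Real.rpow_neg_one, div_neg] using this

theorem hasMellin_expPair_split {a b : ℝ} (ha : 0 < a) (hb : 0 < b) (s : ℂ) :
    HasMellin (expPair a b) s (mellin (expPairTail a b) s + mellin (expPairTail b a) (-s)) := by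
  have h := hasMellin_add (mellinConvergent_expPairTail ha hb.le s)
    (mellinConvergent_comp_inv.2 (mellinConvergent_expPairTail hb ha.le (-s)))
  rw [mellin_comp_inv] at h
  have hae : (fun x : ℝ => (x : ℂ) ^ (s - 1) • (expPairTail a b x + expPairTail b a x⁻¹))
      =ᵐ[volume.restrict (Ioi 0)] fun x : ℝ => (x : ℂ) ^ (s - 1) • expPair a b x := by
    filter_upwards [expPair_ae_eq a b] with x hx
    rw [hx]
  exact ⟨Integrable.congr h.1 hae, (integral_congr_ae hae).symm.trans h.2⟩

theorem mellinConvergent_expPair {a b : ℝ} {s : ℂ}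
    (h : (0 < a ∧ 0 < b) ∨ (0 < a ∧ b = 0 ∧ 0 < s.re) ∨ (a = 0 ∧ 0 < b ∧ s.re < 0)) :
    MellinConvergent (expPair a b) s := by
  rcases h with ⟨ha, hb⟩ | ⟨ha, rfl, hs⟩ | ⟨rfl, hb, hs⟩
  · exact (hasMellin_expPair_split ha hb s).1
  · exact (hasMellin_expPair_zero ha hs).1
  · have : expPair 0 b = fun x => expPair b 0 x⁻¹ := by ext x; rw [expPair_inv]
    rw [this, mellinConvergent_comp_inv]
    exact (hasMellin_expPair_zero hb (by simpa using hs)).1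

theorem mellin_expPairTail_eq (a b : ℝ) (s : ℂ) :
    mellin (expPairTail a b) s = ∫ x in Ioi (1 : ℝ), (x : ℂ) ^ (s - 1) * expPair a b x := by
  unfold mellin expPairTail
  have h : ∀ x : ℝ, (x : ℂ) ^ (s - 1) • (Ioi (1 : ℝ)).indicator (expPair a b) x =
      (Ioi (1 : ℝ)).indicator (fun x : ℝ => (x : ℂ) ^ (s - 1) * expPair a b x) x := fun x => by
    by_cases hx : x ∈ Ioi (1 : ℝ)
    · simp only [indicator_of_mem hx, smul_eq_mul]
    · simp only [indicator_of_notMem hx, smul_zero]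
  simp_rw [h]
  rw [setIntegral_indicator measurableSet_Ioi, Ioi_inter_Ioi]
  norm_num

theorem integrableOn_expPair_Ioi_one {a b : ℝ} (ha : 0 < a) (hb : 0 ≤ b) (s : ℂ) :
    IntegrableOn (fun x : ℝ => (x : ℂ) ^ (s - 1) * expPair a b x) (Ioi 1) := by
  have h := (mellinConvergent_expPairTail ha hb s).mono_set (Ioi_subset_Ioi zero_le_one)
  refine h.congr_fun (fun x hx => ?_) measurableSet_Ioi
  simp only [expPairTail, indicator_of_mem hx, smul_eq_mul]

/-! ### Series for the tails and for the lower incomplete Gamma function -/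

theorem hasSum_mellin_expPairTail {a : ℝ} (ha : 0 < a) (b : ℝ) (s : ℂ) :
    HasSum (fun l : ℕ => (-b : ℂ) ^ l / (l.factorial : ℂ) * mellin (expPairTail a 0) (s - l))
      (mellin (expPairTail a b) s) := by
  have h := hasSum_integral_mul_exp (integrableOn_expPair_Ioi_one ha le_rfl s)
    (u := fun x => x⁻¹) measurable_inv.aestronglyMeasurable (by
      filter_upwards [ae_restrict_mem measurableSet_Ioi] with x hx
      have hx : 1 < x := hx
      rw [abs_of_pos (by positivity)]
      exact (inv_lt_one_of_one_lt₀ hx).le) (-b)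
  convert h using 1
  · ext l
    rw [mellin_expPairTail_eq]
    push_cast
    congr 1
    refine setIntegral_congr_fun measurableSet_Ioi fun x hx => ?_
    have hx : 1 < x := hx
    have hx0 : (x : ℂ) ≠ 0 := by exact_mod_cast (by linarith : x ≠ 0)
    rw [show s - l - 1 = (s - 1) - l by ring, Complex.cpow_sub _ _ hx0, Complex.cpow_natCast,
      inv_pow]
    field_simp
  · rw [mellin_expPairTail_eq]
    refine setIntegral_congr_fun measurableSet_Ioi fun x _ => ?_
    rw [mul_assoc]
    congr 1
    unfold expPair
    rw [← Complex.ofReal_mul, ← Real.exp_add]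
    congr 2; ring

theorem hasSum_exp_ofReal (c : ℝ) :
    HasSum (fun k : ℕ => (c : ℂ) ^ k / (k.factorial : ℂ)) (Real.exp c : ℝ) := by
  rw [Complex.ofReal_exp, Complex.exp_eq_exp_ℂ]
  exact NormedSpace.expSeries_div_hasSum_exp _

/-- The value is `∫_0^1 x^(s-1) e^(-a x) dx`, the Gamma integral without its tail; expand the
exponential and integrate `x^(s+k-1)`. -/
theorem hasSum_lowerGamma_of_re_pos {a : ℝ} (ha : 0 < a) {s : ℂ} (hs : 0 < s.re) :
    HasSum (fun k : ℕ => (-a : ℂ) ^ k / (k.factorial : ℂ) * (s + k)⁻¹)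
      ((a : ℂ) ^ (-s) * Complex.Gamma s - mellin (expPairTail a 0) s) := by
  have hc : IntegrableOn (fun x : ℝ => (x : ℂ) ^ (s - 1)) (Ioc 0 1) := by
    rw [← intervalIntegrable_iff_integrableOn_Ioc_of_le zero_le_one]
    exact intervalIntegral.intervalIntegrable_cpow' (by simpa using hs)
  have h := hasSum_integral_mul_exp hc (u := fun x => x) measurable_id.aestronglyMeasurable (by
      filter_upwards [ae_restrict_mem measurableSet_Ioc] with x hx
      rw [abs_of_pos hx.1]; exact hx.2) (-a)
  convert h using 1
  · ext k
    push_cast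
    congr 1
    have e : ∫ x in Ioc (0 : ℝ) 1, (x : ℂ) ^ (s - 1) * (x : ℂ) ^ k =
        ∫ x in Ioc (0 : ℝ) 1, (x : ℂ) ^ (s + k - 1) := by
      refine setIntegral_congr_fun measurableSet_Ioc fun x hx => ?_
      have hx0 : (x : ℂ) ≠ 0 := by exact_mod_cast hx.1.ne'
      change (x : ℂ) ^ (s - 1) * (x : ℂ) ^ k = (x : ℂ) ^ (s + k - 1)
      rw [show s + k - 1 = (s - 1) + k by ring, Complex.cpow_add _ _ hx0, Complex.cpow_natCast]
    have hre : 0 < (s + k).re := by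
      simp only [Complex.add_re, Complex.natCast_re]; positivity
    have hne : s + k ≠ 0 := fun h0 => by rw [h0] at hre; simp at hre
    rw [e, ← intervalIntegral.integral_of_le zero_le_one,
      integral_cpow (Or.inl (by rw [Complex.sub_re, Complex.one_re]; linarith))]
    simp [Complex.zero_cpow hne]
  · have hm := hasMellin_expPair_zero ha hs
    rw [← hm.2, mellin_expPairTail_eq, mellin, ← Ioc_union_Ioi_eq_Ioi zero_le_one,
      setIntegral_union (Ioc_disjoint_Ioi le_rfl) measurableSet_Ioi
        (hm.1.mono_set Ioc_subset_Ioi_self) (hm.1.mono_set (Ioi_subset_Ioi zero_le_one))]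
    simp only [smul_eq_mul, add_sub_cancel_right, expPair, zero_mul, sub_zero]

theorem hasDerivAt_expPair_zero (a x : ℝ) :
    HasDerivAt (expPair a 0) (-a * expPair a 0 x) x := by
  have h : HasDerivAt (fun x : ℝ => Real.exp (-a * x)) (Real.exp (-a * x) * (-a * 1)) x :=
    ((hasDerivAt_id x).const_mul (-a)).exp
  convert h.ofReal_comp using 1
  · ext x; simp [expPair]
  · simp [expPair, mul_comm]

/-- Integration by parts over `(1, ∞)`; `e^(-a)` is the boundary term at `1`. This is the tail's
counterpart of `Γ(s + 1) = s Γ(s)`. -/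
theorem mul_mellin_expPairTail {a : ℝ} (ha : 0 < a) {s : ℂ} (hs : s ≠ 0) :
    s * mellin (expPairTail a 0) s =
      a * mellin (expPairTail a 0) (s + 1) - (Real.exp (-a) : ℝ) := by
  have hderiv : ∀ x ∈ Ici (1 : ℝ), HasDerivAt (fun x : ℝ => (x : ℂ) ^ s * expPair a 0 x)
      (s * ((x : ℂ) ^ (s - 1) * expPair a 0 x) -
        a * ((x : ℂ) ^ (s + 1 - 1) * expPair a 0 x)) x := by
    intro x hx
    have hx0 : 0 < x := lt_of_lt_of_le one_pos hx
    refine ((hasDerivAt_ofReal_cpow_const hx0.ne' hs).mul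
      (hasDerivAt_expPair_zero a x)).congr_deriv ?_
    rw [add_sub_cancel_right]
    ring
  have hi : ∀ s : ℂ, IntegrableOn (fun x : ℝ => (x : ℂ) ^ (s - 1) * expPair a 0 x) (Ioi 1) :=
    integrableOn_expPair_Ioi_one ha le_rfl
  have htend : Tendsto (fun x : ℝ => (x : ℂ) ^ s * expPair a 0 x) atTop (𝓝 0) := by
    rw [tendsto_zero_iff_norm_tendsto_zero]
    refine (tendsto_rpow_mul_exp_neg_mul_atTop_nhds_zero s.re a ha).congr' ?_
    filter_upwards [eventually_gt_atTop 0] with x hx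
    rw [norm_mul, norm_expPair, Complex.norm_cpow_eq_rpow_re_of_pos hx]
    simp
  have h := integral_Ioi_of_hasDerivAt_of_tendsto' hderiv
    (((hi s).const_mul s).sub ((hi (s + 1)).const_mul (a : ℂ))) htend
  rw [integral_sub ((hi s).const_mul s) ((hi (s + 1)).const_mul (a : ℂ)), integral_const_mul,
    integral_const_mul, ← mellin_expPairTail_eq, ← mellin_expPairTail_eq] at h
  simp only [Complex.ofReal_one, Complex.one_cpow, one_mul, zero_sub] at h
  simp only [expPair, mul_one, zero_mul, sub_zero] at h
  linear_combination h

/-- The power series of the lower incomplete Gamma function, continued analytically in `s`. -/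
theorem hasSum_lowerGamma {a : ℝ} (ha : 0 < a) {s : ℂ} (hs : ¬ IsGammaPole s) :
    HasSum (fun k : ℕ => (-a : ℂ) ^ k / (k.factorial : ℂ) * (s + k)⁻¹)
      ((a : ℂ) ^ (-s) * Complex.Gamma s - mellin (expPairTail a 0) s) := by
  -- The continuation goes left by unit strips: the induction infers the claim at `s` from that at
  -- `s + 1`.
  obtain ⟨n, hn⟩ := exists_nat_gt (-s.re)
  induction n generalizing s with
  | zero => exact hasSum_lowerGamma_of_re_pos ha (by simpa using hn)
  | succ n ih =>
    have hs0 : s ≠ 0 := fun h => hs ⟨0, by simpa using h⟩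
    have ha0 : (a : ℂ) ≠ 0 := by exact_mod_cast ha.ne'
    have hs1 : ¬ IsGammaPole (s + 1) := fun ⟨k, hk⟩ => hs ⟨k + 1, by
      push_cast; linear_combination hk⟩
    have h1 := ih hs1 (by
      simp only [Complex.add_re, Complex.one_re]; push_cast at hn; linarith)
    -- The series at `s + 1`, shifted by one index; the new term `k = 0` vanishes. The series at `s`
    -- follows from `1/(s+k) = s⁻¹ (1 - k/(s+k))`.
    have h2 : HasSum (fun k : ℕ => (-a : ℂ) ^ k / (k.factorial : ℂ) * (k * (s + k)⁻¹))
        (-a * ((a : ℂ) ^ (-(s + 1)) * Complex.Gamma (s + 1) -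
          mellin (expPairTail a 0) (s + 1))) := by
      rw [← hasSum_nat_add_iff' 1]
      simp only [Finset.range_one, Finset.sum_singleton, Nat.cast_zero, zero_mul, mul_zero,
        sub_zero]
      refine (h1.mul_left (-a : ℂ)).congr_fun fun k => ?_
      have hk : (k : ℂ) + 1 ≠ 0 := Nat.cast_add_one_ne_zero k
      rw [Nat.factorial_succ, pow_succ]
      push_cast
      rw [show s + 1 + (k : ℂ) = s + (k + 1) by ring]
      have := Nat.cast_ne_zero (R := ℂ).2 k.factorial_ne_zero
      field_simp
    have h3 := ((hasSum_exp_ofReal (-a)).sub h2).mul_left s⁻¹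
    have e : (a : ℂ) ^ (-s) * Complex.Gamma s - mellin (expPairTail a 0) s =
        s⁻¹ * ((Real.exp (-a) : ℝ) - -a * ((a : ℂ) ^ (-(s + 1)) * Complex.Gamma (s + 1) -
          mellin (expPairTail a 0) (s + 1))) := by
      rw [Complex.Gamma_add_one s hs0, neg_add, Complex.cpow_add _ _ ha0, Complex.cpow_neg_one]
      have := mul_mellin_expPairTail ha hs0
      field_simp
      linear_combination -this
    rw [e]
    refine h3.congr_fun fun k => ?_
    have hk : s + k ≠ 0 := fun h => hs ⟨k, by linear_combination h⟩
    push_cast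
    field_simp
    ring

/-! ### The Bessel-type expansion in powers of `ab` -/

/-- The coefficient `Γ(z) Γ(1 - z) / Γ(1 + l - z)` of the Mellin transform. -/
def besselCoeff (l : ℕ) (z : ℂ) : ℂ :=
  Complex.Gamma z * Complex.Gamma (1 - z) / Complex.Gamma (1 + l - z)

theorem besselCoeff_zero {z : ℂ} (hz : ∀ n : ℤ, z ≠ n) : besselCoeff 0 z = Complex.Gamma z := by
  have : Complex.Gamma (1 - z) ≠ 0 := Complex.Gamma_ne_zero fun m h => hz (m + 1) (by
    push_cast; linear_combination -h)
  simp [besselCoeff, this]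

theorem besselCoeff_succ {z : ℂ} (hz : ∀ n : ℤ, z ≠ n) (l : ℕ) :
    besselCoeff (l + 1) z = besselCoeff l z / (l + 1 - z) := by
  have h : (1 : ℂ) + l - z ≠ 0 := fun h => hz (l + 1) (by push_cast; linear_combination -h)
  unfold besselCoeff
  rw [show (1 : ℂ) + (l + 1 : ℕ) - z = (1 + l - z) + 1 by push_cast; ring,
    Complex.Gamma_add_one _ h, div_div, mul_comm (Complex.Gamma (1 + l - z))]
  congr 2; ring

/-- The expansion produces the left form, while the `I`-functions in (1) contain the Gamma quotient.
-/
theorem neg_one_pow_mul_Gamma {z : ℂ} (hz : ∀ n : ℤ, z ≠ n) (l : ℕ) :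
    (-1) ^ l * Complex.Gamma (z - l) = besselCoeff l z := by
  induction l with
  | zero => simp [besselCoeff_zero hz]
  | succ l ih =>
    have h : z - (l + 1) ≠ 0 := fun h => hz (l + 1) (by push_cast; linear_combination h)
    have h' : (l : ℂ) + 1 - z ≠ 0 := fun h => hz (l + 1) (by push_cast; linear_combination -h)
    rw [besselCoeff_succ hz, ← ih, eq_div_iff h', show z - l = (z - (l + 1)) + 1 by ring,
      Complex.Gamma_add_one _ h]
    push_cast
    ring

theorem exists_pos_le_norm_sub_intCast {z : ℂ} (hz : ∀ n : ℤ, z ≠ n) :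
    ∃ ε > 0, ∀ n : ℤ, ε ≤ ‖z - n‖ := by
  have hcl : IsClosed (range ((↑) : ℤ → ℂ)) := Complex.isClosed_range_intCast
  have hne : (range ((↑) : ℤ → ℂ)).Nonempty := range_nonempty _
  refine ⟨Metric.infDist z (range ((↑) : ℤ → ℂ)), ?_, fun n => ?_⟩
  · exact (hcl.notMem_iff_infDist_pos hne).1 fun ⟨n, hn⟩ => hz n hn.symm
  · rw [← dist_eq_norm]; exact Metric.infDist_le_dist_of_mem ⟨n, rfl⟩

/-- The denominators are differences of `z` and integers, hence bounded away from `0`; what remains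
is a product of two exponential series. -/
theorem summable_besselCross (a b : ℝ) {z : ℂ} (hz : ∀ n : ℤ, z ≠ n) :
    Summable fun q : ℕ × ℕ => (-b : ℂ) ^ q.1 / (q.1.factorial : ℂ) *
      ((-a : ℂ) ^ q.2 / (q.2.factorial : ℂ)) * (z - q.1 + q.2)⁻¹ := by
  obtain ⟨ε, hε, h⟩ := exists_pos_le_norm_sub_intCast hz
  have hs := ((Real.summable_pow_div_factorial |b|).mul_of_nonneg
    (Real.summable_pow_div_factorial |a|) (fun _ => by positivity)
    (fun _ => by positivity)).mul_right ε⁻¹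
  refine hs.of_norm_bounded fun q => ?_
  have := h (q.1 - q.2)
  push_cast at this
  rw [show z - ((q.1 : ℂ) - q.2) = z - q.1 + q.2 by ring] at this
  simp only [norm_mul, norm_div, norm_pow, norm_neg, Complex.norm_real, Complex.norm_natCast,
      Real.norm_eq_abs, norm_inv]
  gcongr

theorem hasSum_mellin_expPair_of_pos {a b : ℝ} (ha : 0 < a) (hb : 0 < b) {z : ℂ}
    (hz : ∀ n : ℤ, z ≠ n) :
    HasSum (fun l : ℕ => ((a : ℂ) ^ (-z) * besselCoeff l z + (b : ℂ) ^ z * besselCoeff l (-z)) *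
      ((a * b) ^ l / (l.factorial : ℂ))) (mellin (expPair a b) z) := by
  have hz' : ∀ n : ℤ, -z ≠ n := fun n h => hz (-n) (by push_cast; linear_combination -h)
  have ha0 : (a : ℂ) ≠ 0 := by exact_mod_cast ha.ne'
  have hb0 : (b : ℂ) ≠ 0 := by exact_mod_cast hb.ne'
  have hS := summable_besselCross a b hz
  have hp : ∀ l : ℕ, ¬ IsGammaPole (z - l) := fun l ⟨k, hk⟩ => hz (l - k) (by
    push_cast; linear_combination hk)
  have hp' : ∀ l : ℕ, ¬ IsGammaPole (-z - l) := fun l ⟨k, hk⟩ => hz' (l - k) (by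
    push_cast; linear_combination hk)
  -- Adding the double series, summed by rows, replaces each incomplete Gamma function by a complete
  -- one.
  have h1 := (hasSum_mellin_expPairTail ha b z).add
    (hS.hasSum.prod_fiberwise fun l => (by
      refine ((hasSum_lowerGamma ha (hp l)).mul_left
        ((-b : ℂ) ^ l / (l.factorial : ℂ))).congr_fun fun k => ?_
      ring))
  -- The other piece needs the same double series summed by columns, with opposite sign because `-z
  -- - k + l = -(z - l + k)`. So it cancels in the sum `h3`.
  have h2 := (hasSum_mellin_expPairTail hb a (-z)).sub
    (((Equiv.prodComm ℕ ℕ).hasSum_iff.2 hS.hasSum).prod_fiberwise fun k => (by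
      refine ((hasSum_lowerGamma hb (hp' k)).mul_left
        (-((-a : ℂ) ^ k / (k.factorial : ℂ)))).congr_fun fun l => ?_
      simp only [Function.comp_apply, Equiv.prodComm_apply, Prod.fst_swap, Prod.snd_swap]
      rw [show -z - k + l = -(z - l + k) by ring, inv_neg]
      ring))
  rw [(hasMellin_expPair_split ha hb z).2]
  have h3 := h1.add h2
  convert h3 using 1
  · ext l
    rw [← neg_one_pow_mul_Gamma hz, ← neg_one_pow_mul_Gamma hz', neg_sub, neg_sub,
      show (l : ℂ) - z = l + -z by ring, show (l : ℂ) - -z = l + z by ring,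
      Complex.cpow_add _ _ ha0, Complex.cpow_add _ _ hb0, Complex.cpow_natCast,
      Complex.cpow_natCast, neg_pow (b : ℂ), neg_pow (a : ℂ), mul_pow]
    ring
  · ring

theorem hasSum_mellin_expPair_of_right_eq_zero {a : ℝ} (ha : 0 < a) {z : ℂ}
    (hz : ∀ n : ℤ, z ≠ n) (hre : 0 < z.re) :
    HasSum (fun l : ℕ => ((a : ℂ) ^ (-z) * besselCoeff l z +
      ((0 : ℝ) : ℂ) ^ z * besselCoeff l (-z)) *
      ((a * (0 : ℝ)) ^ l / (l.factorial : ℂ))) (mellin (expPair a 0) z) := by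
  have hz0 : z ≠ 0 := by exact_mod_cast hz 0
  have h := hasSum_single (f := fun l : ℕ => ((a : ℂ) ^ (-z) * besselCoeff l z +
      ((0 : ℝ) : ℂ) ^ z * besselCoeff l (-z)) * ((a * (0 : ℝ)) ^ l / (l.factorial : ℂ))) 0
    (fun l hl => by simp [hl])
  convert h using 1
  rw [(hasMellin_expPair_zero ha hre).2]
  simp [Complex.zero_cpow hz0, besselCoeff_zero hz]

/-- The Mellin transform of `exp (-a x - b / x)`, which is a modified Bessel function of the
second kind, as a power series in `a b`. -/
theorem hasSum_mellin_expPair {a b : ℝ} {z : ℂ} (hz : ∀ n : ℤ, z ≠ n)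
    (h : (0 < a ∧ 0 < b) ∨ (0 < a ∧ b = 0 ∧ 0 < z.re) ∨ (a = 0 ∧ 0 < b ∧ z.re < 0)) :
    HasSum (fun l : ℕ => ((a : ℂ) ^ (-z) * besselCoeff l z + (b : ℂ) ^ z * besselCoeff l (-z)) *
      ((a * b) ^ l / (l.factorial : ℂ))) (mellin (expPair a b) z) := by
  rcases h with ⟨ha, hb⟩ | ⟨ha, rfl, hs⟩ | ⟨rfl, hb, hs⟩
  · exact hasSum_mellin_expPair_of_pos ha hb hz
  · exact hasSum_mellin_expPair_of_right_eq_zero ha hz hs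
  · have hz' : ∀ n : ℤ, -z ≠ n := fun n h => hz (-n) (by push_cast; linear_combination -h)
    have h := hasSum_mellin_expPair_of_right_eq_zero hb hz' (by simpa using hs)
    have e : mellin (expPair 0 b) z = mellin (expPair b 0) (-z) := by
      rw [← mellin_comp_inv]; simp_rw [expPair_inv]
    rw [e]
    refine h.congr_fun fun l => ?_
    rw [neg_neg, mul_comm (b : ℂ) ((0 : ℝ) : ℂ), add_comm]

/-! ### The effect of additional parameters on `χ` -/

theorem chi_prepend_postpend_upper {m n : ℕ} (hn : n ≤ p) (P : Fin p → Param) (Q : Fin q → Param)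
    (u u' v : Param) (w : ℂ) :
    chi (m + 1) (n + 1) (prepend u (postpend P v)) (prepend u' Q) w =
      gammaPow u.expo (1 - u.shift - u.slope * w) * gammaPow u'.expo (u'.shift + u'.slope * w) /
        gammaPow v.expo (v.shift + v.slope * w) * chi m n P Q w := by
  simp only [chi, Finset.prod_filter, prepend, postpend, Fin.prod_univ_succ (n := q),
    Fin.prod_univ_succ (n := p + 1), Fin.prod_univ_castSucc (n := p), Fin.cons_zero, Fin.cons_succ,
    Fin.snoc_castSucc, Fin.snoc_last, Fin.val_zero, Fin.val_succ, Fin.val_castSucc, Fin.val_last,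
    Nat.zero_lt_succ, if_true, Nat.add_lt_add_iff_right, Nat.add_le_add_iff_right, hn, hn.not_gt,
    Nat.succ_ne_zero, if_false, Nat.le_zero]
  simp only [div_eq_mul_inv, mul_inv, one_mul, mul_one]
  ring

theorem chi_prepend_postpend_lower {m n : ℕ} (hm : m ≤ q) (P : Fin p → Param) (Q : Fin q → Param)
    (u u' v : Param) (w : ℂ) :
    chi (m + 1) (n + 1) (prepend u P) (prepend u' (postpend Q v)) w =
      gammaPow u.expo (1 - u.shift - u.slope * w) * gammaPow u'.expo (u'.shift + u'.slope * w) /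
        gammaPow v.expo (1 - v.shift - v.slope * w) * chi m n P Q w := by
  simp only [chi, Finset.prod_filter, prepend, postpend, Fin.prod_univ_succ (n := p),
    Fin.prod_univ_succ (n := q + 1), Fin.prod_univ_castSucc (n := q), Fin.cons_zero, Fin.cons_succ,
    Fin.snoc_castSucc, Fin.snoc_last, Fin.val_zero, Fin.val_succ, Fin.val_castSucc, Fin.val_last,
    Nat.zero_lt_succ, if_true, Nat.add_lt_add_iff_right, Nat.add_le_add_iff_right, hm, hm.not_gt,
    Nat.succ_ne_zero, if_false, Nat.le_zero]
  simp only [div_eq_mul_inv, mul_inv, one_mul, mul_one]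
  ring

/-! ### Behaviour along the path -/

/-- For `x > 0` take absolute values in Euler's integral. Moving left by `Γ(z) = Γ(z + 1)/z` keeps
the bound, since `|z| ≥ 1`. -/
theorem exists_norm_Gamma_le_on_vertical (x : ℝ) :
    ∃ M, ∀ z : ℂ, z.re = x → 1 ≤ |z.im| → ‖Complex.Gamma z‖ ≤ M := by
  obtain ⟨n, hn⟩ := exists_nat_gt (-x)
  induction n generalizing x with
  | zero =>
    refine ⟨∫ y in Ioi (0 : ℝ), ‖((Real.exp (-y) : ℝ) : ℂ) * (y : ℂ) ^ ((x : ℂ) - 1)‖,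
      fun z hz _ => ?_⟩
    have hx : 0 < z.re := by rw [hz]; simpa using hn
    rw [Complex.Gamma_eq_integral hx, Complex.GammaIntegral]
    refine (norm_integral_le_integral_norm _).trans_eq ?_
    refine setIntegral_congr_fun measurableSet_Ioi fun y hy => ?_
    have hy : 0 < y := hy
    simp only [norm_mul, Complex.norm_cpow_eq_rpow_re_of_pos hy, Complex.sub_re, hz,
      Complex.ofReal_re]
  | succ n ih =>
    obtain ⟨M, hM⟩ := ih (x + 1) (by push_cast at hn; linarith)
    refine ⟨M, fun z hz him => ?_⟩
    have h1 : 1 ≤ ‖z‖ := him.trans (Complex.abs_im_le_norm z)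
    have hz0 : z ≠ 0 := by rintro rfl; simp at h1; linarith
    have h := hM (z + 1) (by simp [hz]) (by simpa using him)
    rw [Complex.Gamma_add_one z hz0, norm_mul] at h
    exact (le_mul_of_one_le_left (norm_nonneg _) h1).trans h

theorem Contour.continuous (C : Contour) : Continuous C.path :=
  let ⟨_, h⟩ := C.lipschitz
  h.continuous

/-- A compact piece of the path is handled by continuity, the rest by a bound on one vertical line.
If `σ = 0`, the argument of `g` is constant. -/
theorem Contour.exists_le_of_continuousAt (C : Contour) (κ : ℂ) (σ : ℝ) {g : ℂ → ℝ}
    (hg : ∀ t, ContinuousAt g (κ - σ * C.path t))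
    (htail : ∃ M, ∀ z : ℂ, z.re = κ.re - σ * C.c → 1 ≤ |z.im| → g z ≤ M) :
    ∃ M, ∀ t, g (κ - σ * C.path t) ≤ M := by
  rcases eq_or_ne σ 0 with rfl | hσ
  · exact ⟨g κ, fun t => by simp⟩
  obtain ⟨M, hM⟩ := htail
  obtain ⟨T, hT⟩ := C.tail
  set S := max T ((1 + |κ.im|) / |σ|) with hS
  have hcont : Continuous fun t => g (κ - σ * C.path t) := by
    refine continuous_iff_continuousAt.2 fun t => ?_
    exact ContinuousAt.comp (f := fun t => κ - σ * C.path t) (hg t)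
      (continuous_const.sub (continuous_const.mul C.continuous)).continuousAt
  obtain ⟨M', hM'⟩ := (isCompact_Icc (a := -S) (b := S)).bddAbove_image hcont.continuousOn
  refine ⟨max M M', fun t => ?_⟩
  rcases le_total |t| S with h | h
  · exact (hM' ⟨t, abs_le.1 h, rfl⟩).trans (le_max_right _ _)
  · refine (hM _ ?_ ?_).trans (le_max_left _ _)
    · rw [hT t ((le_max_left _ _).trans h)]
      simp
    · rw [hT t ((le_max_left _ _).trans h)]
      have h1 : 1 + |κ.im| ≤ |σ * t| := by
        rw [abs_mul, ← div_le_iff₀' (abs_pos.2 hσ)]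
        exact (le_max_right _ _).trans h
      have h2 := abs_sub_abs_le_abs_sub (σ * t) κ.im
      simp only [Complex.sub_im, Complex.mul_im, Complex.add_im, Complex.ofReal_im,
        Complex.ofReal_re, Complex.I_im, Complex.I_re]
      rw [abs_sub_comm]
      ring_nf at h2 ⊢
      ring_nf at h1
      linarith

/-- The parameter of the Bessel function, at the point `C.path t`, is never an integer. -/
theorem Contour.ne_intCast_of_separates {C : Contour} {m n : ℕ} {P : Fin p → Param}
    {Q : Fin q → Param} {α σ : ℝ} {s : ℂ}
    (hC : Separates C (m + 1) (n + 1)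
      (prepend ⟨2 - α - s, σ, 1⟩ P) (prepend ⟨2 - α - s, σ, 1⟩ Q)) (t : ℝ) (k : ℤ) :
    α + s - 1 - σ * C.path t ≠ k := by
  intro h
  have hmem : C.path t ∈ range C.path := ⟨t, rfl⟩
  -- An integer `k ≤ 0` would be a pole of `Γ(ν)`, and `k ≥ 1` one of `Γ(1 - ν)`. Either would have
  -- to lie strictly to one side of the path, hence off it.
  rcases le_or_gt k 0 with hk | hk
  · obtain ⟨j, hj⟩ := Int.eq_ofNat_of_zero_le (neg_nonneg.2 hk)
    have hj' : (k : ℂ) = -(j : ℂ) := by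
      rw [← neg_eq_iff_eq_neg]; exact_mod_cast congrArg (Int.cast (R := ℂ)) hj
    obtain ⟨r, hr⟩ := hC.2 0 (Nat.zero_lt_succ n) (C.path t) ⟨j, by
      simp only [prepend, Fin.cons_zero]
      linear_combination h + hj'⟩
    exact (hr r le_rfl).source_mem hmem
  · obtain ⟨j, hj⟩ := Int.eq_ofNat_of_zero_le (show 0 ≤ k - 1 by omega)
    have hj' : (k : ℂ) - 1 = j := by exact_mod_cast congrArg (Int.cast (R := ℂ)) hj
    obtain ⟨r, hr⟩ := hC.1 0 (Nat.zero_lt_succ m) (C.path t) ⟨j, by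
      simp only [prepend, Fin.cons_zero]
      linear_combination -h - hj'⟩
    exact (hr r le_rfl).source_mem hmem

theorem ofReal_mul_cpow {r : ℝ} (hr : 0 ≤ r) (x z : ℂ) :
    ((r : ℂ) * x) ^ z = (r : ℂ) ^ z * x ^ z := by
  rcases eq_or_lt_of_le hr with rfl | hr
  · rcases eq_or_ne z 0 with rfl | hz <;> simp [*]
  rcases eq_or_ne x 0 with rfl | hx
  · rcases eq_or_ne z 0 with rfl | hz <;> simp [*]
  have hr0 : (r : ℂ) ≠ 0 := by exact_mod_cast hr.ne'
  rw [Complex.cpow_def_of_ne_zero hr0, Complex.cpow_def_of_ne_zero hx,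
    Complex.cpow_def_of_ne_zero (mul_ne_zero hr0 hx), Complex.log_ofReal_mul hr hx,
    Complex.ofReal_log hr.le, add_mul, Complex.exp_add]

/-! ### Integration of the expansion over a family of orders -/

/-- A continuous family of orders `ν t` of Bessel functions, along which all that occurs in the
expansion of the Mellin transform of `expPair a b` stays bounded. -/
structure BesselOrders (a b : ℝ) (ν : ℝ → ℂ) : Prop where
  continuous : Continuous ν
  ne_intCast : ∀ t (k : ℤ), ν t ≠ k
  left_nonneg : 0 ≤ a
  right_nonneg : 0 ≤ b
  cases : ∀ t, (0 < a ∧ 0 < b) ∨ (0 < a ∧ b = 0 ∧ 0 < (ν t).re) ∨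
    (a = 0 ∧ 0 < b ∧ (ν t).re < 0)
  norm_Gamma_le : ∃ M, ∀ t, ‖Complex.Gamma (ν t)‖ ≤ M
  norm_Gamma_neg_le : ∃ M, ∀ t, ‖Complex.Gamma (-ν t)‖ ≤ M
  le_norm_sub : ∃ ε > 0, ∀ t (k : ℤ), ε ≤ ‖ν t - k‖
  re_mem : ∃ r₁ r₂ : ℝ, (∀ t, (ν t).re ∈ Icc r₁ r₂) ∧
    MellinConvergent (expPair a b) r₁ ∧ MellinConvergent (expPair a b) r₂

theorem norm_besselCoeff_le {z : ℂ} {ε : ℝ} (hε : 0 < ε) (h : ∀ k : ℤ, ε ≤ ‖z - k‖) (l : ℕ) :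
    ‖besselCoeff l z‖ ≤ ‖Complex.Gamma z‖ * (ε⁻¹) ^ l := by
  have hz : ∀ k : ℤ, z ≠ k := fun k hk => by
    have := h k; rw [hk, sub_self, norm_zero] at this; linarith
  induction l with
  | zero => simp [besselCoeff_zero hz]
  | succ l ih =>
    rw [besselCoeff_succ hz, norm_div, pow_succ, ← mul_assoc, div_eq_mul_inv]
    have h1 := h (l + 1)
    rw [norm_sub_rev] at h1
    push_cast at h1
    gcongr

namespace BesselOrders

variable {a b : ℝ} {ν : ℝ → ℂ}

/-- The substitution `x ↦ 1/x`; through it each estimate for the `a`-half also serves the `b`-half.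
-/
theorem symm (h : BesselOrders a b ν) : BesselOrders b a (fun t => -ν t) where
  continuous := h.continuous.neg
  ne_intCast t k hk := h.ne_intCast t (-k) (by push_cast; linear_combination -hk)
  left_nonneg := h.right_nonneg
  right_nonneg := h.left_nonneg
  cases t := by
    have := h.cases t
    simp only [Complex.neg_re, Left.neg_pos_iff, Left.neg_neg_iff]
    tauto
  norm_Gamma_le := h.norm_Gamma_neg_le
  norm_Gamma_neg_le := by simpa using h.norm_Gamma_le
  le_norm_sub := by
    obtain ⟨ε, hε, H⟩ := h.le_norm_sub
    refine ⟨ε, hε, fun t k => ?_⟩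
    have := H t (-k)
    rw [← norm_neg] at this
    push_cast at this
    rwa [show -(ν t - -(k : ℂ)) = -ν t - k by ring] at this
  re_mem := by
    obtain ⟨r₁, r₂, H, h1, h2⟩ := h.re_mem
    have key : ∀ r : ℝ, MellinConvergent (expPair a b) r → MellinConvergent (expPair b a)
        ((-r : ℝ) : ℂ) := fun r hr => by
      have e : expPair b a = fun x => expPair a b x⁻¹ := by ext x; rw [expPair_inv]
      rw [e, mellinConvergent_comp_inv]
      simpa using hr
    exact ⟨-r₂, -r₁, fun t => ⟨neg_le_neg (H t).2, neg_le_neg (H t).1⟩, key _ h2, key _ h1⟩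

theorem norm_besselCoeff_le (h : BesselOrders a b ν) :
    ∃ M R, 0 ≤ M ∧ 0 ≤ R ∧ ∀ t l, ‖besselCoeff l (ν t)‖ ≤ M * R ^ l := by
  obtain ⟨ε, hε, H⟩ := h.le_norm_sub
  obtain ⟨M, hM⟩ := h.norm_Gamma_le
  refine ⟨M, ε⁻¹, (norm_nonneg _).trans (hM 0), by positivity, fun t l => ?_⟩
  refine (IFunction.norm_besselCoeff_le hε (H t) l).trans ?_
  gcongr
  exact hM t

theorem continuous_besselCoeff (h : BesselOrders a b ν) (l : ℕ) :
    Continuous fun t => besselCoeff l (ν t) := by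
  unfold besselCoeff
  simp_rw [div_eq_mul_inv]
  refine (Continuous.mul ?_ ?_).mul ?_
  · refine continuous_iff_continuousAt.2 fun t => ?_
    exact (Complex.differentiableAt_Gamma _ fun m hm => h.ne_intCast t (-m)
      (by push_cast; exact hm)).continuousAt.comp h.continuous.continuousAt
  · refine continuous_iff_continuousAt.2 fun t => ?_
    refine ContinuousAt.comp (f := fun t => 1 - ν t) (Complex.differentiableAt_Gamma _
      fun m hm => h.ne_intCast t (m + 1) ?_).continuousAt
      (continuous_const.sub h.continuous).continuousAt
    push_cast; linear_combination -hm
  · exact Complex.differentiable_one_div_Gamma.continuous.comp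
      (continuous_const.sub h.continuous)

theorem norm_cpow_neg_le (h : BesselOrders a b ν) : ∃ M, ∀ t, ‖(a : ℂ) ^ (-ν t)‖ ≤ M := by
  rcases h.left_nonneg.eq_or_lt with h0 | ha
  · refine ⟨0, fun t => ?_⟩
    rw [← h0, Complex.ofReal_zero, Complex.zero_cpow (neg_ne_zero.2 fun hz =>
      h.ne_intCast t 0 (by simpa using hz)), norm_zero]
  · obtain ⟨r₁, r₂, H, -, -⟩ := h.re_mem
    refine ⟨a ^ (-r₁) + a ^ (-r₂), fun t => ?_⟩
    rw [Complex.norm_cpow_eq_rpow_re_of_pos ha, Complex.neg_re]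
    rcases le_total 1 a with h1 | h1
    · have := Real.rpow_le_rpow_of_exponent_le h1 (neg_le_neg (H t).1)
      have := Real.rpow_nonneg ha.le (-r₂)
      linarith
    · have := Real.rpow_le_rpow_of_exponent_ge ha h1 (neg_le_neg (H t).2)
      have := Real.rpow_nonneg ha.le (-r₁)
      linarith

theorem measurable_cpow_neg (h : BesselOrders a b ν) : Measurable fun t => (a : ℂ) ^ (-ν t) :=
  measurable_const.pow h.continuous.measurable.neg

theorem integrable_mul_besselCoeff (hν : BesselOrders a b ν) {h : ℝ → ℂ} (hh : Integrable h)
    (l : ℕ) : Integrable fun t => h t * besselCoeff l (ν t) := by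
  obtain ⟨M, R, -, -, H⟩ := hν.norm_besselCoeff_le
  exact hh.mul_bdd (c := M * R ^ l) (hν.continuous_besselCoeff l).aestronglyMeasurable
    (Eventually.of_forall fun t => H t l)

theorem integrable_mul_cpow_mul_besselCoeff (hν : BesselOrders a b ν) {h : ℝ → ℂ}
    (hh : Integrable h) (l : ℕ) :
    Integrable fun t => h t * ((a : ℂ) ^ (-ν t) * besselCoeff l (ν t)) := by
  obtain ⟨M, H⟩ := hν.norm_cpow_neg_le
  have := (hν.integrable_mul_besselCoeff hh l).mul_bdd (c := M)
    hν.measurable_cpow_neg.aestronglyMeasurable (Eventually.of_forall H)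
  exact this.congr (Eventually.of_forall fun t => by simp only; ring)

/-- The `L¹` norms of the terms are bounded by multiples of `(R |ab|)^l / l!`, summable however
large `R` is. -/
theorem hasSum_integral_mul_mellin (hν : BesselOrders a b ν) {h : ℝ → ℂ} (hh : Integrable h) :
    HasSum (fun l : ℕ => ((∫ t, h t * ((a : ℂ) ^ (-ν t) * besselCoeff l (ν t))) +
        ∫ t, h t * ((b : ℂ) ^ (ν t) * besselCoeff l (-ν t))) * ((a * b) ^ l / (l.factorial : ℂ)))
      (∫ t, h t * mellin (expPair a b) (ν t)) := by
  have hi := hν.integrable_mul_cpow_mul_besselCoeff hh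
  have hi' := hν.symm.integrable_mul_cpow_mul_besselCoeff hh
  simp only [neg_neg] at hi'
  obtain ⟨M₁, R₁, hM₁, hR₁, H₁⟩ := hν.norm_besselCoeff_le
  obtain ⟨M₂, R₂, hM₂, hR₂, H₂⟩ := hν.symm.norm_besselCoeff_le
  obtain ⟨N₁, K₁⟩ := hν.norm_cpow_neg_le
  obtain ⟨N₂, K₂⟩ := hν.symm.norm_cpow_neg_le
  simp only [neg_neg] at K₂
  have hN₁ : 0 ≤ N₁ := (norm_nonneg _).trans (K₁ 0)
  have hN₂ : 0 ≤ N₂ := (norm_nonneg _).trans (K₂ 0)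
  have hF : ∀ l : ℕ, Integrable fun t => (h t * ((a : ℂ) ^ (-ν t) * besselCoeff l (ν t)) +
      h t * ((b : ℂ) ^ (ν t) * besselCoeff l (-ν t))) * ((a * b) ^ l / (l.factorial : ℂ)) :=
    fun l => ((hi l).add (hi' l)).mul_const _
  have key := hasSum_integral_of_summable_integral_norm hF ?_
  · have e : ∫ t, h t * mellin (expPair a b) (ν t) = ∫ t, ∑' l : ℕ,
        (h t * ((a : ℂ) ^ (-ν t) * besselCoeff l (ν t)) +
          h t * ((b : ℂ) ^ (ν t) * besselCoeff l (-ν t))) * ((a * b) ^ l / (l.factorial : ℂ)) := by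
      refine integral_congr_ae (Eventually.of_forall fun t => ?_)
      refine (((hasSum_mellin_expPair (hν.ne_intCast t) (hν.cases t)).mul_left
        (h t)).congr_fun fun l => ?_).tsum_eq.symm
      ring
    rw [e]
    refine key.congr_fun fun l => ?_
    rw [integral_mul_const, integral_add (hi l) (hi' l)]
  · have hs : Summable fun l : ℕ => (∫ t, ‖h t‖) *
        (N₁ * M₁ * ((R₁ * |a * b|) ^ l / (l.factorial : ℝ)) +
          N₂ * M₂ * ((R₂ * |a * b|) ^ l / (l.factorial : ℝ))) :=
      (((Real.summable_pow_div_factorial _).mul_left _).add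
        ((Real.summable_pow_div_factorial _).mul_left _)).mul_left _
    refine hs.of_nonneg_of_le (fun l => integral_nonneg fun t => norm_nonneg _) fun l => ?_
    rw [← integral_mul_const]
    refine integral_mono (hF l).norm (hh.norm.mul_const _) fun t => ?_
    simp only
    rw [← mul_add, mul_assoc, norm_mul]
    refine mul_le_mul_of_nonneg_left ?_ (norm_nonneg _)
    have e : ‖((a : ℂ) * b) ^ l / (l.factorial : ℂ)‖ = |a * b| ^ l / (l.factorial : ℝ) := by
      rw [norm_div, norm_pow, Complex.norm_natCast, ← Complex.ofReal_mul, Complex.norm_real,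
        Real.norm_eq_abs]
    rw [norm_mul, e]
    calc _ ≤ (N₁ * (M₁ * R₁ ^ l) + N₂ * (M₂ * R₂ ^ l)) * (|a * b| ^ l / (l.factorial : ℝ)) := by
          refine mul_le_mul_of_nonneg_right ((norm_add_le _ _).trans (add_le_add ?_ ?_))
            (by positivity)
          · rw [norm_mul]
            exact mul_le_mul (K₁ t) (H₁ t l) (norm_nonneg _) hN₁
          · rw [norm_mul]
            exact mul_le_mul (K₂ t) (H₂ t l) (norm_nonneg _) hN₂
      _ = _ := by rw [mul_pow, mul_pow]; ring

/-- With `Re ν` in `[r₁, r₂]`, `x^(Re ν - 1) ≤ x^(r₁ - 1) + x^(r₂ - 1)`, so a product of integrable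
functions dominates. This justifies Fubini. -/
theorem integrable_prod (hν : BesselOrders a b ν) {h : ℝ → ℂ} (hh : Integrable h) :
    Integrable (fun y : ℝ × ℝ => (y.1 : ℂ) ^ (ν y.2 - 1) * expPair a b y.1 * h y.2)
      ((volume.restrict (Ioi 0)).prod volume) := by
  obtain ⟨r₁, r₂, H, h1, h2⟩ := hν.re_mem
  refine Integrable.mono' ((h1.norm.add h2.norm).mul_prod hh.norm) ?_ ?_
  · refine AEStronglyMeasurable.mul (Measurable.aestronglyMeasurable ?_) hh.1.comp_snd
    exact ((Complex.measurable_ofReal.comp measurable_fst).pow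
      ((hν.continuous.measurable.comp measurable_snd).sub_const 1)).mul
        ((measurable_expPair a b).comp measurable_fst)
  · have hpos : ∀ᵐ y ∂((volume.restrict (Ioi (0 : ℝ))).prod (volume : Measure ℝ)), 0 < y.1 :=
      Measure.quasiMeasurePreserving_fst.ae (ae_restrict_mem measurableSet_Ioi)
    filter_upwards [hpos] with y hy
    rw [norm_mul, norm_mul]
    refine mul_le_mul_of_nonneg_right ?_ (norm_nonneg _)
    simp only [Pi.add_apply, norm_smul]
    rw [← add_mul]
    refine mul_le_mul_of_nonneg_right ?_ (norm_nonneg _)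
    simp only [Complex.norm_cpow_eq_rpow_re_of_pos hy, Complex.sub_re, Complex.one_re,
      Complex.ofReal_re]
    have p1 := Real.rpow_nonneg hy.le (r₁ - 1)
    have p2 := Real.rpow_nonneg hy.le (r₂ - 1)
    rcases le_total 1 y.1 with h1 | h1
    · have := Real.rpow_le_rpow_of_exponent_le h1 (sub_le_sub_right (H y.2).2 1)
      linarith
    · have := Real.rpow_le_rpow_of_exponent_ge hy h1 (sub_le_sub_right (H y.2).1 1)
      linarith

theorem integrableOn_integral (hν : BesselOrders a b ν) {h : ℝ → ℂ} (hh : Integrable h) :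
    IntegrableOn (fun x : ℝ => ∫ t, (x : ℂ) ^ (ν t - 1) * expPair a b x * h t) (Ioi 0) :=
  (hν.integrable_prod hh).integral_prod_left

theorem integral_integral (hν : BesselOrders a b ν) {h : ℝ → ℂ} (hh : Integrable h) :
    ∫ x in Ioi (0 : ℝ), ∫ t, (x : ℂ) ^ (ν t - 1) * expPair a b x * h t =
      ∫ t, h t * mellin (expPair a b) (ν t) := by
  rw [integral_integral_swap (hν.integrable_prod hh)]
  refine integral_congr_ae (Eventually.of_forall fun t => ?_)
  simp only [mellin, smul_eq_mul]
  rw [integral_mul_const, mul_comm]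

end BesselOrders

/-! ### Moments of a random variable with a given density -/

theorem integrable_cpow_of_map_eq_withDensity {f : ℝ → ℂ} {s : ℂ} (hf : MellinConvergent f s)
    (hf0 : ∀ x ≤ 0, f x = 0) (hf1 : ∀ x, (f x).im = 0 ∧ 0 ≤ (f x).re)
    {Ω : Type*} [MeasurableSpace Ω] {μ : Measure Ω} {X : Ω → ℝ} (hX : AEMeasurable X μ)
    (hmap : μ.map X = volume.withDensity fun x => ENNReal.ofReal (f x).re) :
    Integrable (fun ω => (X ω : ℂ) ^ (s - 1)) μ ∧ ∫ ω, (X ω : ℂ) ^ (s - 1) ∂μ = mellin f s := by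
  have hg : Measurable fun x : ℝ => (x : ℂ) ^ (s - 1) := Complex.measurable_ofReal.pow_const _
  have hind : (Ioi (0 : ℝ)).indicator f = f := by
    refine indicator_eq_self.2 fun x hx => ?_
    by_contra h
    exact hx (hf0 x (not_lt.1 h))
  -- Mellin convergence makes `x^(s-1) f(x)` measurable on `(0, ∞)`, and `x^(s-1)` has no zero
  -- there.
  have hfm : AEMeasurable f := by
    rw [← hind, aemeasurable_indicator_iff measurableSet_Ioi]
    have h1 : AEMeasurable (fun x : ℝ => ((x : ℂ) ^ (s - 1))⁻¹ * ((x : ℂ) ^ (s - 1) • f x))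
        (volume.restrict (Ioi 0)) := hg.inv.aemeasurable.mul hf.1.aemeasurable
    refine h1.congr ?_
    filter_upwards [ae_restrict_mem measurableSet_Ioi] with x hx
    have hx0 : (x : ℂ) ≠ 0 := by exact_mod_cast (ne_of_gt hx)
    rw [smul_eq_mul, inv_mul_cancel_left₀ (by simp [Complex.cpow_eq_zero_iff, hx0])]
  have hd : AEMeasurable (fun x => ENNReal.ofReal (f x).re) :=
    (Complex.measurable_re.comp_aemeasurable hfm).ennreal_ofReal
  have htop : ∀ᵐ x : ℝ, ENNReal.ofReal (f x).re < ⊤ := Eventually.of_forall fun _ =>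
    ENNReal.ofReal_lt_top
  have e : (fun x : ℝ => (ENNReal.ofReal (f x).re).toReal • (x : ℂ) ^ (s - 1)) =
      (Ioi (0 : ℝ)).indicator fun x : ℝ => (x : ℂ) ^ (s - 1) • f x := by
    ext x
    rw [ENNReal.toReal_ofReal (hf1 x).2, Complex.real_smul,
      show (((f x).re : ℝ) : ℂ) = f x from Complex.ext rfl (by simp [(hf1 x).1])]
    by_cases hx : x ∈ Ioi (0 : ℝ)
    · rw [indicator_of_mem hx, smul_eq_mul, mul_comm]
    · rw [indicator_of_notMem hx, hf0 x (not_lt.1 hx), zero_mul]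
  constructor
  · rw [← Function.comp_def (fun x : ℝ => (x : ℂ) ^ (s - 1)) X,
      ← integrable_map_measure hg.aestronglyMeasurable hX, hmap,
      integrable_withDensity_iff_integrable_smul₀' hd htop, e, integrable_indicator_iff
      measurableSet_Ioi]
    exact hf
  · rw [← integral_map hX (f := fun x : ℝ => (x : ℂ) ^ (s - 1)) hg.aestronglyMeasurable, hmap,
      integral_withDensity_eq_integral_toReal_smul₀ hd htop, e, integral_indicator
      measurableSet_Ioi, mellin]

/-! ### Uniform bounds for `ν = κ - σ w` on the path -/

theorem Contour.exists_norm_Gamma_le (C : Contour) {κ : ℂ} {σ : ℝ}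
    (hne : ∀ t (k : ℤ), κ - σ * C.path t ≠ k) :
    ∃ M, ∀ t, ‖Complex.Gamma (κ - σ * C.path t)‖ ≤ M :=
  C.exists_le_of_continuousAt κ σ (g := fun z => ‖Complex.Gamma z‖)
    (fun t => (Complex.differentiableAt_Gamma _ fun m hm => hne t (-m)
      (by push_cast; exact hm)).continuousAt.norm) (exists_norm_Gamma_le_on_vertical _)

theorem Contour.exists_re_mem_Icc (C : Contour) (κ : ℂ) (σ : ℝ) :
    ∃ r₁ r₂, ∀ t, (κ - σ * C.path t).re ∈ Icc r₁ r₂ := by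
  obtain ⟨M₁, H₁⟩ := C.exists_le_of_continuousAt κ σ (g := fun z => -z.re)
    (fun t => Complex.continuous_re.neg.continuousAt)
    ⟨-(κ.re - σ * C.c), fun z hz _ => by rw [hz]⟩
  obtain ⟨M₂, H₂⟩ := C.exists_le_of_continuousAt κ σ (g := fun z => z.re)
    (fun t => Complex.continuous_re.continuousAt) ⟨κ.re - σ * C.c, fun z hz _ => hz.le⟩
  exact ⟨-M₁, M₂, fun t => ⟨neg_le.1 (H₁ t), H₂ t⟩⟩

theorem Contour.exists_pos_le_re (C : Contour) {κ : ℂ} {σ : ℝ}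
    (hpos : ∀ t, 0 < (κ - σ * C.path t).re) : ∃ r > 0, ∀ t, r ≤ (κ - σ * C.path t).re := by
  obtain ⟨M, H⟩ := C.exists_le_of_continuousAt κ σ (g := fun z => z.re⁻¹)
    (fun t => Complex.continuous_re.continuousAt.inv₀ (hpos t).ne')
    ⟨(κ.re - σ * C.c)⁻¹, fun z hz _ => by rw [hz]⟩
  have hM : 0 < M := (inv_pos.2 (hpos 0)).trans_le (H 0)
  exact ⟨M⁻¹, inv_pos.2 hM, fun t => (inv_le_comm₀ hM (hpos t)).2 (H t)⟩

/-- The reciprocal distance to the integers is continuous along the path, and at most `1` where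
`|Im| ≥ 1`. -/
theorem Contour.exists_pos_le_norm_sub_intCast (C : Contour) {κ : ℂ} {σ : ℝ}
    (hne : ∀ t (k : ℤ), κ - σ * C.path t ≠ k) :
    ∃ ε > 0, ∀ t (k : ℤ), ε ≤ ‖κ - σ * C.path t - k‖ := by
  set Z : Set ℂ := range ((↑) : ℤ → ℂ)
  have hpos : ∀ z : ℂ, (∀ k : ℤ, z ≠ k) → 0 < Metric.infDist z Z := fun z hz =>
    (Complex.isClosed_range_intCast.notMem_iff_infDist_pos (range_nonempty _)).1
      fun ⟨k, hk⟩ => hz k hk.symm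
  obtain ⟨M, H⟩ := C.exists_le_of_continuousAt κ σ (g := fun z => (Metric.infDist z Z)⁻¹)
    (fun t => (Metric.continuous_infDist_pt Z).continuousAt.inv₀ (hpos _ (hne t)).ne')
    ⟨1, fun z _ him => inv_le_one_of_one_le₀ <|
      (Metric.le_infDist (range_nonempty _)).2 fun y ⟨k, hk⟩ => by
        rw [dist_eq_norm, ← hk]
        refine le_trans ?_ (Complex.abs_im_le_norm _)
        simpa using him⟩
  have hM : 0 < M := (inv_pos.2 (hpos _ (hne 0))).trans_le (H 0)
  refine ⟨M⁻¹, inv_pos.2 hM, fun t k => ?_⟩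
  refine ((inv_le_comm₀ hM (hpos _ (hne t))).2 (H t)).trans ?_
  rw [← dist_eq_norm]
  exact Metric.infDist_le_dist_of_mem ⟨k, rfl⟩

theorem Contour.exists_norm_cpow_neg_le (C : Contour) {r : ℝ} (hr : 0 ≤ r) :
    ∃ M, ∀ t, ‖(r : ℂ) ^ (-C.path t)‖ ≤ M := by
  rcases hr.eq_or_lt with rfl | hr
  · refine ⟨1, fun t => ?_⟩
    rcases eq_or_ne (C.path t) 0 with h | h
    · simp [h]
    · simp [Complex.zero_cpow (neg_ne_zero.2 h)]
  · obtain ⟨M, H⟩ := C.exists_le_of_continuousAt 0 1 (g := fun z => r ^ z.re)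
      (fun t => ((Real.continuous_const_rpow hr.ne').comp Complex.continuous_re).continuousAt)
      ⟨r ^ ((0 : ℂ).re - 1 * C.c), fun z hz _ => by rw [hz]⟩
    refine ⟨M, fun t => ?_⟩
    rw [Complex.norm_cpow_eq_rpow_re_of_pos hr]
    simpa using H t

theorem Contour.integrable_mul_cpow_neg (C : Contour) {r : ℝ} (hr : 0 ≤ r) {h : ℝ → ℂ}
    (hh : Integrable h) : Integrable fun t => h t * (r : ℂ) ^ (-C.path t) := by
  obtain ⟨M, H⟩ := C.exists_norm_cpow_neg_le hr
  exact hh.mul_bdd (measurable_const.pow C.continuous.measurable.neg).aestronglyMeasurable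
    (Eventually.of_forall H)

theorem Contour.besselOrders (C : Contour) {κ : ℂ} {σ a b : ℝ}
    (hne : ∀ t (k : ℤ), κ - σ * C.path t ≠ k) (ha0 : 0 ≤ a) (hb0 : 0 ≤ b) (hab : 0 < a ∨ 0 < b)
    (hb : b = 0 → ∀ t : ℝ, 0 < (κ - σ * C.path t).re) (ha : a = 0 → σ = 0 ∧ κ.re < 0) :
    BesselOrders a b (fun t => κ - σ * C.path t) where
  continuous := continuous_const.sub (continuous_const.mul C.continuous)
  ne_intCast := hne
  left_nonneg := ha0
  right_nonneg := hb0
  cases t := by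
    rcases ha0.eq_or_lt with h | h
    · obtain ⟨rfl, hκ⟩ := ha h.symm
      exact Or.inr (Or.inr ⟨h.symm, hab.resolve_left h.not_lt, by simpa using hκ⟩)
    · rcases hb0.eq_or_lt with h' | h'
      · exact Or.inr (Or.inl ⟨h, h'.symm, hb h'.symm t⟩)
      · exact Or.inl ⟨h, h'⟩
  norm_Gamma_le := C.exists_norm_Gamma_le hne
  norm_Gamma_neg_le := by
    have h := C.exists_norm_Gamma_le (κ := -κ) (σ := -σ) fun t k hk => hne t (-k) (by
      push_cast at hk ⊢; linear_combination -hk)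
    refine h.imp fun M H t => ?_
    have := H t
    push_cast at this
    rwa [show -κ - -(σ : ℂ) * C.path t = -(κ - σ * C.path t) by ring] at this
  le_norm_sub := C.exists_pos_le_norm_sub_intCast hne
  re_mem := by
    obtain ⟨r₁, r₂, H⟩ := C.exists_re_mem_Icc κ σ
    -- For `a = 0` the order is constant and the strip shrinks to a line. For `b = 0` its left edge
    -- must be positive, which needs `Re ν` bounded away from `0`.
    rcases ha0.eq_or_lt with h | h
    · obtain ⟨rfl, hκ⟩ := ha h.symm
      have hc : MellinConvergent (expPair a b) (κ.re : ℝ) := mellinConvergent_expPair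
        (Or.inr (Or.inr ⟨h.symm, hab.resolve_left h.not_lt, by simpa using hκ⟩))
      exact ⟨κ.re, κ.re, fun t => by simp, hc, hc⟩
    · rcases hb0.eq_or_lt with h' | h'
      · obtain ⟨r, hr, H'⟩ := C.exists_pos_le_re (hb h'.symm)
        have hc : ∀ x : ℝ, 0 < x → MellinConvergent (expPair a b) x := fun x hx =>
          mellinConvergent_expPair (Or.inr (Or.inl ⟨h, h'.symm, by simpa using hx⟩))
        exact ⟨r, r₂, fun t => ⟨H' t, (H t).2⟩, hc r hr, hc r₂ (hr.trans_le ((H' 0).trans (H 0).2))⟩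
      · have hc : ∀ x : ℝ, MellinConvergent (expPair a b) x := fun x =>
          mellinConvergent_expPair (Or.inl ⟨h, h'⟩)
        exact ⟨r₁, r₂, H, hc _, hc _⟩

/-! ### The integrands on the right of (1) -/

/-- From `Γ(z)Γ(1-z) = -Γ(-z)Γ(1+z)`; this is the source of the minus sign in (1). -/
theorem Gamma_mul_Gamma_one_sub_div (l : ℕ) {z : ℂ} (hz : z ≠ 0) :
    Complex.Gamma z * Complex.Gamma (1 - z) / Complex.Gamma (1 + l + z) = -besselCoeff l (-z) := by
  unfold besselCoeff
  rw [sub_neg_eq_add, sub_neg_eq_add, add_comm 1 z, Complex.Gamma_add_one z hz,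
    show 1 - z = -z + 1 by ring, Complex.Gamma_add_one (-z) (neg_ne_zero.2 hz)]
  ring

theorem integrand_ofReal_mul (C : Contour) (m n : ℕ) (P : Fin p → Param) (Q : Fin q → Param)
    (δ : ℂ) {r : ℝ} (hr : 0 ≤ r) (t : ℝ) :
    integrand C m n P Q (r * δ) t = integrand C m n P Q δ t * (r : ℂ) ^ (-C.path t) := by
  unfold integrand
  rw [ofReal_mul_cpow hr]
  ring

section

variable {m n : ℕ} {P : Fin p → Param} {Q : Fin q → Param} {α σ : ℝ} {s : ℂ} (δ : ℂ) (C : Contour)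

theorem integrand_prepend_postpend_upper (hn : n ≤ p) (l : ℕ) (t : ℝ) :
    integrand C (m + 1) (n + 1)
        (prepend ⟨2 - α - s, σ, 1⟩ (postpend P ⟨2 + l - α - s, σ, 1⟩))
        (prepend ⟨2 - α - s, σ, 1⟩ Q) δ t =
      integrand C m n P Q δ t * besselCoeff l (α + s - 1 - σ * C.path t) := by
  unfold integrand besselCoeff
  rw [chi_prepend_postpend_upper hn]
  simp only [gammaPow_one]
  rw [show 1 - (2 - α - s) - σ * C.path t = α + s - 1 - σ * C.path t by ring,
    show 2 - α - s + σ * C.path t = 1 - (α + s - 1 - σ * C.path t) by ring,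
    show 2 + l - α - s + σ * C.path t = 1 + l - (α + s - 1 - σ * C.path t) by ring]
  ring

theorem integrand_prepend_postpend_lower (hm : m ≤ q) (l : ℕ) (t : ℝ)
    (hne : α + s - 1 - σ * C.path t ≠ 0) :
    integrand C (m + 1) (n + 1)
        (prepend ⟨2 - α - s, σ, 1⟩ P)
        (prepend ⟨2 - α - s, σ, 1⟩ (postpend Q ⟨1 - l - α - s, σ, 1⟩)) δ t =
      -(integrand C m n P Q δ t * besselCoeff l (-(α + s - 1 - σ * C.path t))) := by
  unfold integrand
  rw [chi_prepend_postpend_lower hm]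
  simp only [gammaPow_one]
  rw [show 1 - (2 - α - s) - σ * C.path t = α + s - 1 - σ * C.path t by ring,
    show 2 - α - s + σ * C.path t = 1 - (α + s - 1 - σ * C.path t) by ring,
    show 1 - (1 - l - α - s) - σ * C.path t = 1 + l + (α + s - 1 - σ * C.path t) by ring,
    Gamma_mul_Gamma_one_sub_div l hne]
  ring

end

theorem cpow_mul_rpow_cpow_neg {r : ℝ} (hr : 0 ≤ r) {κ w : ℂ} {σ : ℝ}
    (hne : κ - σ * w ≠ 0) :
    (r : ℂ) ^ κ * ((r ^ σ : ℝ) : ℂ) ^ (-w) = (r : ℂ) ^ (κ - σ * w) := by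
  rcases hr.eq_or_lt with rfl | hr
  · rw [Complex.ofReal_zero, Complex.zero_cpow hne]
    -- With base `0` the right side is `0`. If `κ = 0`, then `0 ^ κ = 1`, but `σ` and `w` are
    -- nonzero and the second factor vanishes.
    rcases eq_or_ne κ 0 with rfl | hκ
    · have hσ : σ ≠ 0 := by rintro rfl; simp at hne
      have hw : w ≠ 0 := by rintro rfl; simp at hne
      simp [Real.zero_rpow hσ, Complex.zero_cpow (neg_ne_zero.2 hw)]
    · simp [Complex.zero_cpow hκ]
  · have hr0 : (r : ℂ) ≠ 0 := by exact_mod_cast hr.ne'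
    rw [← Complex.cpow_mul_ofReal_nonneg hr.le, ← Complex.cpow_add _ _ hr0]
    congr 1; ring

end IFunction

end

/-! ### The Mellin transform of the density -/

open IFunction in
theorem theorem5p1 {p q : ℕ} (m n : ℕ) (hm : m ≤ q) (hn : n ≤ p)
    -- parameters of the `I`-function
    (P : Fin p → Param) (Q : Fin q → Param)
    (hP : ∀ i, 0 < (P i).slope ∧ 0 < (P i).expo)
    (hQ : ∀ j, 0 < (Q j).slope ∧ 0 < (Q j).expo)
    -- parameters of the density
    (k₂ δ : ℂ) (hδ : δ ≠ 0) (a b α σ : ℝ) (hσ : 0 ≤ σ)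
    (hpos : 0 < α → 0 < a ∧ 0 ≤ b) (hneg : α < 0 → 0 ≤ a ∧ 0 < b)
    (hzero : α = 0 → 0 < a ∧ 0 < b)
    -- the point `s`, and a path that is admissible for the `I`-functions of the claim
    (s : ℂ) (C : Contour)
    (hC : Separates C (m + 1) (n + 1)
      (prepend ⟨2 - α - s, σ, 1⟩ P) (prepend ⟨2 - α - s, σ, 1⟩ Q))
    -- absolute convergence of the integrals in the density and in its Mellin transform
    (hconv : ConvergesAt C m n P Q δ)
    (hb : b = 0 → ∀ t : ℝ, 0 < ((α : ℂ) + s - 1 - σ * C.path t).re)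
    (ha : a = 0 → σ = 0 ∧ ((α : ℂ) + s - 1).re < 0) :
    -- everything converges absolutely
    (∀ x : ℝ, 0 < x → ConvergesAt C m n P Q (δ * ((x ^ σ : ℝ) : ℂ))) ∧
    MellinConvergent (ifigDensity C m n P Q k₂ δ a b α σ) s ∧
    (∀ l : ℕ,
      ConvergesAt C (m + 1) (n + 1)
        (prepend ⟨2 - α - s, σ, 1⟩ (postpend P ⟨2 + l - α - s, σ, 1⟩))
        (prepend ⟨2 - α - s, σ, 1⟩ Q) (δ / ((a ^ σ : ℝ) : ℂ)) ∧
      ConvergesAt C (m + 1) (n + 1)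
        (prepend ⟨2 - α - s, σ, 1⟩ P)
        (prepend ⟨2 - α - s, σ, 1⟩ (postpend Q ⟨1 - l - α - s, σ, 1⟩))
        (((b ^ σ : ℝ) : ℂ) * δ)) ∧
    Summable (ifigMellinTerm C m n P Q δ a b α σ s) ∧
    -- the Mellin transform of the density
    mellin (ifigDensity C m n P Q k₂ δ a b α σ) s
      = k₂ * ∑' l : ℕ, ifigMellinTerm C m n P Q δ a b α σ s l ∧
    -- and of a random variable that has it as its probability density function
    ∀ {Ω : Type*} [MeasurableSpace Ω] (μ : Measure Ω) [IsProbabilityMeasure μ] (X : Ω → ℝ),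
      AEMeasurable X μ →
      (∀ x, (ifigDensity C m n P Q k₂ δ a b α σ x).im = 0 ∧
        0 ≤ (ifigDensity C m n P Q k₂ δ a b α σ x).re) →
      μ.map X = volume.withDensity
        (fun x => ENNReal.ofReal (ifigDensity C m n P Q k₂ δ a b α σ x).re) →
      Integrable (fun ω => (X ω : ℂ) ^ (s - 1)) μ ∧
      ∫ ω, (X ω : ℂ) ^ (s - 1) ∂μ
        = k₂ * ∑' l : ℕ, ifigMellinTerm C m n P Q δ a b α σ s l := by
  set κ : ℂ := α + s - 1 with hκ
  set ν : ℝ → ℂ := fun t => κ - σ * C.path t with hνdef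
  set h : ℝ → ℂ := integrand C m n P Q δ with hh
  have hne : ∀ t (k : ℤ), κ - σ * C.path t ≠ k := C.ne_intCast_of_separates hC
  have hne0 : ∀ t, κ - σ * C.path t ≠ 0 := fun t => by simpa using hne t 0
  have hsign : 0 ≤ a ∧ 0 ≤ b ∧ (0 < a ∨ 0 < b) := by
    rcases lt_trichotomy α 0 with h | h | h
    · exact ⟨(hneg h).1, (hneg h).2.le, Or.inr (hneg h).2⟩
    · exact ⟨(hzero h).1.le, (hzero h).2.le, Or.inl (hzero h).1⟩
    · exact ⟨(hpos h).1.le, (hpos h).2, Or.inl (hpos h).1⟩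
  obtain ⟨ha0, hb0, hab⟩ := hsign
  have hν : BesselOrders a b ν := C.besselOrders hne ha0 hb0 hab hb ha
  have hint : Integrable h := hconv
  have hdiv : δ / ((a ^ σ : ℝ) : ℂ) = (((a ^ σ)⁻¹ : ℝ) : ℂ) * δ := by
    push_cast; rw [div_eq_inv_mul]
  have hapos : 0 ≤ (a ^ σ)⁻¹ := inv_nonneg.2 (Real.rpow_nonneg ha0 σ)
  have hbpos : 0 ≤ b ^ σ := Real.rpow_nonneg hb0 σ
  have hacpow : ∀ t, (a : ℂ) ^ (-(α : ℂ) - s + 1) * (((a ^ σ)⁻¹ : ℝ) : ℂ) ^ (-C.path t) =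
      (a : ℂ) ^ (-ν t) := fun t => by
    rcases ha0.eq_or_lt with h0 | h0
    -- Here `σ = 0`, so `a ^ σ = 0 ^ 0 = 1` and its power drops out.
    · obtain ⟨rfl, -⟩ := ha h0.symm
      simp [hνdef, hκ]
      congr 1; ring
    · rw [← Real.rpow_neg ha0, show (-(α : ℂ) - s + 1) = -κ by rw [hκ]; ring,
        cpow_mul_rpow_cpow_neg ha0]
      · congr 1; simp only [hνdef]; push_cast; ring
      · push_cast
        exact fun h0 => hne0 t (by linear_combination -h0)
  -- the integrands of the `I`-functions in the series
  have hupper : ∀ (l : ℕ) t, integrand C (m + 1) (n + 1)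
        (prepend ⟨2 - α - s, σ, 1⟩ (postpend P ⟨2 + l - α - s, σ, 1⟩))
        (prepend ⟨2 - α - s, σ, 1⟩ Q) (δ / ((a ^ σ : ℝ) : ℂ)) t =
      h t * besselCoeff l (ν t) * (((a ^ σ)⁻¹ : ℝ) : ℂ) ^ (-C.path t) := fun l t => by
    rw [hdiv, integrand_ofReal_mul _ _ _ _ _ _ hapos, integrand_prepend_postpend_upper _ _ hn]
  have hlower : ∀ (l : ℕ) t, integrand C (m + 1) (n + 1)
        (prepend ⟨2 - α - s, σ, 1⟩ P)
        (prepend ⟨2 - α - s, σ, 1⟩ (postpend Q ⟨1 - l - α - s, σ, 1⟩))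
        (((b ^ σ : ℝ) : ℂ) * δ) t =
      -(h t * besselCoeff l (-ν t) * ((b ^ σ : ℝ) : ℂ) ^ (-C.path t)) := fun l t => by
    rw [integrand_ofReal_mul _ _ _ _ _ _ hbpos,
      integrand_prepend_postpend_lower _ _ hm _ _ (hne0 t),
      neg_mul]
  have hterm : ∀ l, ifigMellinTerm C m n P Q δ a b α σ s l = (2 * (Real.pi : ℂ) * Complex.I)⁻¹ *
      (((∫ t, h t * ((a : ℂ) ^ (-ν t) * besselCoeff l (ν t))) +
        ∫ t, h t * ((b : ℂ) ^ (ν t) * besselCoeff l (-ν t))) *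
          ((a * b) ^ l / (l.factorial : ℂ))) := fun l => by
    have e1 : (a : ℂ) ^ (-(α : ℂ) - s + 1) * ∫ t, integrand C (m + 1) (n + 1)
        (prepend ⟨2 - α - s, σ, 1⟩ (postpend P ⟨2 + l - α - s, σ, 1⟩))
        (prepend ⟨2 - α - s, σ, 1⟩ Q) (δ / ((a ^ σ : ℝ) : ℂ)) t =
        ∫ t, h t * ((a : ℂ) ^ (-ν t) * besselCoeff l (ν t)) := by
      rw [← integral_const_mul]
      refine integral_congr_ae (Filter.Eventually.of_forall fun t => ?_)
      simp only [hupper, ← hacpow]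
      ring
    have e2 : (b : ℂ) ^ ((α : ℂ) + s - 1) * ∫ t, integrand C (m + 1) (n + 1)
        (prepend ⟨2 - α - s, σ, 1⟩ P)
        (prepend ⟨2 - α - s, σ, 1⟩ (postpend Q ⟨1 - l - α - s, σ, 1⟩))
        (((b ^ σ : ℝ) : ℂ) * δ) t =
        -∫ t, h t * ((b : ℂ) ^ (ν t) * besselCoeff l (-ν t)) := by
      rw [← integral_const_mul, ← integral_neg]
      refine integral_congr_ae (Filter.Eventually.of_forall fun t => ?_)
      have e : (b : ℂ) ^ ((α : ℂ) + s - 1) * ((b ^ σ : ℝ) : ℂ) ^ (-C.path t) = (b : ℂ) ^ ν t :=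
        cpow_mul_rpow_cpow_neg hb0 (hne0 t)
      simp only [hlower, ← e]
      ring
    unfold ifigMellinTerm I
    rw [mul_left_comm, e1, mul_left_comm ((b : ℂ) ^ _), e2]
    push_cast
    ring
  have hsum : HasSum (ifigMellinTerm C m n P Q δ a b α σ s)
      ((2 * (Real.pi : ℂ) * Complex.I)⁻¹ * ∫ t, h t * mellin (expPair a b) (ν t)) :=
    ((hν.hasSum_integral_mul_mellin hint).mul_left _).congr_fun hterm
  have hdens : EqOn (fun x : ℝ => (x : ℂ) ^ (s - 1) • ifigDensity C m n P Q k₂ δ a b α σ x)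
      (fun x : ℝ => k₂ * (2 * (Real.pi : ℂ) * Complex.I)⁻¹ *
        ∫ t, (x : ℂ) ^ (ν t - 1) * expPair a b x * h t) (Ioi 0) := fun x hx => by
    have hx : 0 < x := hx
    have hx0 : (x : ℂ) ≠ 0 := by exact_mod_cast hx.ne'
    -- The Mellin kernel, the density and `(x^σ)^(-w)` contribute the exponents `s - 1`, `α - 1` and
    -- `-σ w`, with sum `ν - 1`.
    have e : ∀ t, (x : ℂ) ^ (ν t - 1) * expPair a b x * h t =
        (x : ℂ) ^ (s - 1) * (x : ℂ) ^ ((α : ℂ) - 1) * expPair a b x *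
          integrand C m n P Q (δ * ((x ^ σ : ℝ) : ℂ)) t := fun t => by
      rw [mul_comm δ, integrand_ofReal_mul _ _ _ _ _ _ (Real.rpow_nonneg hx.le σ),
        ← Complex.cpow_mul_ofReal_nonneg hx.le, show ν t - 1 = (s - 1) + (α - 1) + σ * -C.path t by
          simp only [hνdef, hκ]; ring, Complex.cpow_add _ _ hx0, Complex.cpow_add _ _ hx0]
      ring
    simp_rw [e]
    rw [integral_const_mul]
    simp only [ifigDensity, if_pos hx, I, smul_eq_mul, expPair]
    rw [Complex.ofReal_mul, Complex.ofReal_cpow hx.le]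
    push_cast
    ring
  have hmc : MellinConvergent (ifigDensity C m n P Q k₂ δ a b α σ) s :=
    IntegrableOn.congr_fun ((hν.integrableOn_integral hint).const_mul _) hdens.symm
      measurableSet_Ioi
  have hmellin : mellin (ifigDensity C m n P Q k₂ δ a b α σ) s =
      k₂ * ∑' l : ℕ, ifigMellinTerm C m n P Q δ a b α σ s l := by
    rw [hsum.tsum_eq, mellin, setIntegral_congr_fun measurableSet_Ioi hdens, integral_const_mul,
      hν.integral_integral hint, mul_assoc]
  refine ⟨fun x hx => ?_, hmc, fun l => ⟨?_, ?_⟩, hsum.summable, hmellin, ?_⟩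
  · have hr := Real.rpow_nonneg hx.le σ
    refine (C.integrable_mul_cpow_neg hr hint).congr (Filter.Eventually.of_forall fun t => ?_)
    simp only [mul_comm δ, integrand_ofReal_mul _ _ _ _ _ _ hr, hh]
  · exact (C.integrable_mul_cpow_neg hapos (hν.integrable_mul_besselCoeff hint l)).congr
      (Filter.Eventually.of_forall fun t => (hupper l t).symm)
  · exact (C.integrable_mul_cpow_neg hbpos (hν.symm.integrable_mul_besselCoeff hint l)).neg.congr
      (Filter.Eventually.of_forall fun t => (hlower l t).symm)
  · intro Ω _ μ _ X hX hreal hmap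
    have := integrable_cpow_of_map_eq_withDensity hmc
      (fun x hx => by simp [ifigDensity, not_lt.2 hx]) hreal hX hmap
    exact ⟨this.1, this.2.trans hmellin⟩
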